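/- A (parameterized) decision problem $(P,m)$ consists of a language $P$ over a finite alphabet together with a size parameter $m$, a function from strings to $\mathbb{N}$. Write $|x|$ for the length of a string $x$. We say that $(P_1,m_1)$ is short L-$m$-reducible to $(P_2,m_2)$, written $(P_1,m_1)\leq^{\mathrm{sL}}_{m}(P_2,m_2)$, if there are a function $f$ in $\mathrm{FL}$ (that is, $f$ is polynomially bounded in length and is computed by a deterministic multi-tape Turing machine with a read-only input tape and a write-only output tape which halts on every input $x$ and uses at most $c\log|x|+d$ cells of each work tape, for constants $c,d\ge 0$, where $\log 0=0$) and a constant $k_1>0$ such that for every string $x$: (i) $x\in P_1$ if and only if $f(x)\in P_2$, and (ii) $m_2(f(x))\leq k_1 m_1(x)+k_1$. Write $(P_1,m_1)\equiv^{\mathrm{sL}}_{m}(P_2,m_2)$ if both $(P_1,m_1)\leq^{\mathrm{sL}}_{m}(P_2,m_2)$ and $(P_2,m_2)\leq^{\mathrm{sL}}_{m}(P_1,m_1)$ hold. Formulas in conjunctive normal form are written as strings in the usual way, with variable indices in binary; a 2CNF formula is one in which every clause has at most two literals. For $k\geq 1$, $\mathrm{2SAT}_k$ is the set of (codes of) satisfiable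 2CNF formulas $\phi$ such that, for each variable $v$, the number of occurrences of $v$ and $\overline{v}$ in $\phi$ is at most $k$. For a string $x$ that encodes a CNF formula, $m_{vbl}(x)$ and $m_{cls}(x)$ denote the number of distinct variables and the number of clauses appearing in it, respectively; both are $0$ if $x$ encodes no formula. **Lemma.** (1) For every $m\in\{m_{vbl},m_{cls}\}$ and every integer $k\geq 3$, $(\mathrm{2SAT}_k,m)\equiv^{\mathrm{sL}}_{m}(\mathrm{2SAT}_3,m)$. (2) $(\mathrm{2SAT}_3,m_{vbl})\equiv^{\mathrm{sL}}_{m}(\mathrm{2SAT}_3,m_{cls})$. -/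

import Mathlib

/-! ## Deterministic log-space transducers -/

namespace LogSpace

/-- A head movement. -/
inductive Move
  | left
  | stay
  | right

/-- What the input head may see: an end marker or an input letter. -/
inductive InSym (α : Type)
  | leftEnd
  | rightEnd
  | letter (a : α)

/-- A deterministic multi-tape Turing machine with a two-way read-only input tape (input alphabet
`α`, the input stands between two end markers), `tapes` many read-write work tapes that are
infinite to the right, and a write-only output tape (output alphabet `β`). A transition looks at
the state, the scanned input symbol and the scanned work symbols; `none` means that the machine
halts, otherwise it gives the new state, the move of the input head, the symbol written and the
move made on every work tape, and possibly one output letter. -/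
structure Machine (α β : Type) where
  State : Type
  finiteState : Finite State
  WorkSym : Type
  finiteWorkSym : Finite WorkSym
  blank : WorkSym
  tapes : ℕ
  start : State
  trans : State → InSym α → (Fin tapes → WorkSym) →
    Option (State × Move × (Fin tapes → WorkSym × Move) × Option β)

namespace Machine

variable {α β : Type}

/-- A configuration: state, position of the input head (`0` is the left end marker), positions of
the work heads, contents of the work tapes, and the word written on the output tape so far. -/
structure Cfg (M : Machine α β) where
  state : M.State
  inPos : ℕ
  workPos : Fin M.tapes → ℕ
  work : Fin M.tapes → ℕ → M.WorkSym
  output : List β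

/-- Cell `0` of the input tape holds the left end marker, cells `1, …, |x|` hold the letters of
`x`, and cell `|x| + 1` holds the right end marker. -/
def readInput (x : List α) : ℕ → InSym α
  | 0 => InSym.leftEnd
  | p + 1 => match x[p]? with
    | some a => InSym.letter a
    | none => InSym.rightEnd

/-- The input head never leaves the cells `0, …, n + 1`, where `n` is the length of the input. -/
def moveInput (n : ℕ) (p : ℕ) : Move → ℕ
  | Move.left => p - 1
  | Move.stay => p
  | Move.right => min (p + 1) (n + 1)

/-- A work head that is asked to move left from the leftmost cell `0` stays there. -/
def moveWork (p : ℕ) : Move → ℕ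
  | Move.left => p - 1
  | Move.stay => p
  | Move.right => p + 1

/-- At the start all work tapes are blank, the output is empty, all work heads are at the leftmost
cell and the input head is at the left end marker. -/
def init (M : Machine α β) : Cfg M where
  state := M.start
  inPos := 0
  workPos := fun _ => 0
  work := fun _ _ => M.blank
  output := []

/-- One step of the machine on input `x`; `none` if the machine has halted. -/
def next (M : Machine α β) (x : List α) (c : Cfg M) : Option (Cfg M) :=
  (M.trans c.state (readInput x c.inPos) (fun i => c.work i (c.workPos i))).map fun t =>
    { state := t.1
      inPos := moveInput x.length c.inPos t.2.1
      workPos := fun i => moveWork (c.workPos i) (t.2.2.1 i).2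
      work := fun i => Function.update (c.work i) (c.workPos i) (t.2.2.1 i).1
      output := c.output ++ t.2.2.2.toList }

/-- The configurations that occur in the computation of `M` on input `x`. -/
def Reaches (M : Machine α β) (x : List α) (c : Cfg M) : Prop :=
  Relation.ReflTransGen (fun c₁ c₂ => M.next x c₁ = some c₂) M.init c

/-- `M` halts on every input `x`, with `f x` written on the output tape. -/
def Computes (M : Machine α β) (f : List α → List β) : Prop :=
  ∀ x, ∃ c, M.Reaches x c ∧ M.next x c = none ∧ c.output = f x

/-- On every input `x`, at most `s |x|` cells of each work tape are visited (the input tape and the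
output tape are not counted). -/
def UsesSpace (M : Machine α β) (s : ℕ → ℕ) : Prop :=
  ∀ x c, M.Reaches x c → ∀ i, c.workPos i + 1 ≤ s x.length

end Machine

/-- The class FL of the polynomially bounded functions that a deterministic Turing machine computes
in space `c log |x| + d`. (`Nat.log 2 n` is the logarithm to base 2, rounded down, with
`Nat.log 2 0 = 0`; the rounding is absorbed by the constants.) -/
def FL {α β : Type} (f : List α → List β) : Prop :=
  (∃ e : ℕ, ∀ x, (f x).length ≤ x.length ^ e + e) ∧
  ∃ (M : Machine α β) (c d : ℕ), M.Computes f ∧ M.UsesSpace fun n => c * Nat.log 2 n + d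

/-- A decision problem over the alphabet `α` together with a size parameter. -/
structure ParamProblem (α : Type) where
  lang : Set (List α)
  size : List α → ℕ

/-- Short L-m-reducibility. -/
def ShortReducible {α β : Type} (P : ParamProblem α) (Q : ParamProblem β) : Prop :=
  ∃ f : List α → List β, FL f ∧ ∃ k₁ : ℕ, 0 < k₁ ∧
    ∀ x, (x ∈ P.lang ↔ f x ∈ Q.lang) ∧ Q.size (f x) ≤ k₁ * P.size x + k₁

/-- Equivalence under short L-m-reductions. -/
def ShortEquiv {α β : Type} (P : ParamProblem α) (Q : ParamProblem β) : Prop :=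
  ShortReducible P Q ∧ ShortReducible Q P

end LogSpace

/-! ## Formulas in conjunctive normal form and the problems 2SAT_k -/

namespace TwoSat

/-- The literal `x_var` (if `pos = true`) or its negation (if `pos = false`). -/
structure Literal where
  var : ℕ
  pos : Bool

/-- A clause is a disjunction of literals. -/
abbrev Clause := List Literal

/-- A formula in conjunctive normal form is a conjunction of clauses. -/
abbrev CNF := List Clause

/-- Every clause has at most two literals. -/
def IsTwoCNF (φ : CNF) : Prop := ∀ c ∈ φ, c.length ≤ 2

/-- Some truth assignment makes a literal of every clause true. -/
def Satisfiable (φ : CNF) : Prop :=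
  ∃ σ : ℕ → Bool, ∀ c ∈ φ, ∃ l ∈ c, σ l.var = l.pos

/-- The number of occurrences of `x_v` and of its negation in `φ`. -/
def occurrences (φ : CNF) (v : ℕ) : ℕ := (φ.flatten.map Literal.var).count v

/-- The number of distinct variables that appear in `φ`. -/
def numVars (φ : CNF) : ℕ := (φ.flatten.map Literal.var).toFinset.card

/-- The number of clauses of `φ`. -/
def numClauses (φ : CNF) : ℕ := φ.length

/-- The alphabet in which formulas are written: binary digits, the signs that open a positive or a
negative literal, and a symbol that closes a clause. -/
inductive Sym
  | bit (b : Bool)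
  | sign (pos : Bool)
  | endClause

/-- A literal is written as its sign followed by the binary digits of the index of its variable
(least significant digit first). -/
def encodeLiteral (l : Literal) : List Sym := Sym.sign l.pos :: l.var.bits.map Sym.bit

/-- A clause is written as the sequence of its literals, closed by the end-of-clause symbol. -/
def encodeClause (c : Clause) : List Sym := c.flatMap encodeLiteral ++ [Sym.endClause]

/-- A formula is written as the sequence of its clauses. -/
def encode (φ : CNF) : List Sym := φ.flatMap encodeClause

/-- A right-to-left scanner that recovers a formula from its code. -/
def scan : Sym → List Bool × CNF → List Bool × CNF
  | Sym.bit b, (bs, φ) => (b :: bs, φ)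
  | Sym.sign s, (bs, c :: φ) => ([], (⟨bs.foldr Nat.bit 0, s⟩ :: c) :: φ)
  | Sym.sign _, (_, []) => ([], [])
  | Sym.endClause, (_, φ) => ([], [] :: φ)

theorem foldr_bit_bits (n : ℕ) : n.bits.foldr Nat.bit 0 = n := by
  induction n using Nat.binaryRec' with
  | zero => simp
  | bit b n h ih => rw [Nat.bits_append_bit n b h]; simp [ih]

theorem foldr_scan_bits (bs : List Bool) (φ : CNF) :
    (bs.map Sym.bit).foldr scan ([], φ) = (bs, φ) := by
  induction bs with
  | nil => rfl
  | cons b bs ih => simp [ih, scan]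

theorem foldr_scan_lits (c d : Clause) (φ : CNF) :
    (c.flatMap encodeLiteral).foldr scan ([], d :: φ) = ([], (c ++ d) :: φ) := by
  induction c with
  | nil => rfl
  | cons l c ih =>
    simp [List.flatMap_cons, ih, encodeLiteral, foldr_scan_bits, scan, foldr_bit_bits]

theorem foldr_scan_encode (φ : CNF) : (encode φ).foldr scan ([], []) = ([], φ) := by
  induction φ with
  | nil => rfl
  | cons c φ ih =>
    have h : encode (c :: φ) = encodeClause c ++ encode φ := rfl
    rw [h, List.foldr_append, ih, encodeClause, List.foldr_append]
    simpa [scan] using foldr_scan_lits c [] φ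

theorem encode_injective : Function.Injective encode := by
  intro φ ψ h
  have := foldr_scan_encode φ
  rw [h, foldr_scan_encode ψ] at this
  exact (congrArg Prod.snd this).symm

open Classical in
/-- The size parameter on strings given by a numerical quantity of formulas: the value at the
formula that is encoded, and `0` for strings that encode no formula. -/
noncomputable def onStrings (g : CNF → ℕ) (x : List Sym) : ℕ :=
  if h : ∃ φ, encode φ = x then g h.choose else 0

theorem onStrings_encode (g : CNF → ℕ) (φ : CNF) : onStrings g (encode φ) = g φ := by
  have h : ∃ ψ, encode ψ = encode φ := ⟨φ, rfl⟩
  rw [onStrings, dif_pos h, encode_injective h.choose_spec]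

theorem onStrings_of_not_code (g : CNF → ℕ) (x : List Sym) (h : ¬ ∃ φ, encode φ = x) :
    onStrings g x = 0 := dif_neg h

/-- The size parameter `m_vbl`: the number of variables. -/
noncomputable def mVbl : List Sym → ℕ := onStrings numVars

/-- The size parameter `m_cls`: the number of clauses. -/
noncomputable def mCls : List Sym → ℕ := onStrings numClauses

/-- The language 2SAT_k: the codes of the satisfiable 2CNF formulas in which every variable occurs,
negated or not, at most `k` times. -/
def twoSAT (k : ℕ) : Set (List Sym) :=
  {x | ∃ φ : CNF, encode φ = x ∧ IsTwoCNF φ ∧ Satisfiable φ ∧ ∀ v, occurrences φ v ≤ k}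

end TwoSat

/-! A single construction proves both parts. Let every clause of a formula have one or two literals
and let every variable occur at most `k` times. Each occurrence of a variable `v` is replaced by a
copy of `v`, numbered by how many occurrences of `v` come later, and for every `v` the implications
copy 0 → copy 1 → … → copy `k - 1` → copy 0 are added. A copy is used at most once in the renamed
clauses (`nodup_renameVars`) and at most twice in the cycle (`count_varsOf_cyclesCNF`), hence at
most three times in all. The cycle forces all copies to agree, so satisfiability is preserved in
both directions (`Satisfiable.reduceCNF`, `satisfiable_of_reduceCNF`).

With `n` variables and `c` clauses the result has at most `k n` variables and exactly `c + k n`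
clauses. Moreover `n ≤ 2 c`, and `c ≤ k n` because no clause is empty. So both size parameters are
linearly equivalent on these inputs, and the construction is a short reduction between any two of
the problems, whichever parameters are chosen (`shortReducible`). Any other input is a no-instance;
its image ends in a stray digit, hence encodes no formula and has size 0.

The remaining work is membership in FL (`fl_reduction`). Copy `j` of `v` is the number `2 ^ j * (2 *
v + 1)`, whose digits are a short unary prefix followed by the digits of `v`, so only copying and
comparing substrings of the input is needed. This is written as a program with nested loops over
input positions. Such programs compile to register machines whose registers never exceed `|x| + 1`
(`Prog.eval_run`), and these are simulated on one work tape that stores all registers in binary,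
column by column (`RegMachine.sim_run`), which takes logarithmic space. -/

namespace LogSpace

/-! ## Runs of deterministic systems -/

/-- The deterministic system `step` leads from one configuration to another one, and every
configuration that is left on the way is `good`. -/
def RunIn {C : Type} (step : C → Option C) (good : C → Prop) : C → C → Prop :=
  Relation.ReflTransGen fun a b => good a ∧ step a = some b

namespace RunIn

variable {C : Type} {step : C → Option C} {good : C → Prop}

theorem refl (a : C) : RunIn step good a a := Relation.ReflTransGen.refl

theorem trans {a b c : C} (h : RunIn step good a b) (h' : RunIn step good b c) :
    RunIn step good a c := Relation.ReflTransGen.trans h h'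

theorem single {a b : C} (h : good a) (h' : step a = some b) : RunIn step good a b :=
  Relation.ReflTransGen.single ⟨h, h'⟩

theorem reaches {a b : C} (h : RunIn step good a b) :
    Relation.ReflTransGen (fun a b => step a = some b) a b :=
  Relation.ReflTransGen.mono (fun _ _ h => h.2) _ _ h

/-- If a run through good configurations halts in a good one, everything reachable is good. -/
theorem good_of_reaches {a b d : C} (h : RunIn step good a b) (hb : good b)
    (hhalt : step b = none) (hd : Relation.ReflTransGen (fun a b => step a = some b) a d) :
    good d := by
  induction h using Relation.ReflTransGen.head_induction_on with
  | refl =>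
    rcases hd.cases_head with rfl | ⟨c, hc, -⟩
    · exact hb
    · simp [hhalt] at hc
  | head h₁ _ ih =>
    rcases hd.cases_head with rfl | ⟨c, hc, hcd⟩
    · exact h₁.1
    · rw [h₁.2, Option.some.injEq] at hc
      exact ih (hc ▸ hcd)

end RunIn

/-! ## Register machines -/

/-- A deterministic machine with a two-way input head and finitely many registers for natural
numbers. A transition looks at the state, the scanned input symbol and the equalities between the
registers; it changes the state, moves the input head, replaces every register by another register
or by zero, possibly plus one, and possibly writes an output letter. -/
structure RegMachine (α β : Type) where
  State : Type
  finiteState : Finite State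
  Reg : Type
  finiteReg : Finite Reg
  start : State
  trans : State → InSym α → (Reg → Reg → Bool) →
    Option (State × Move × (Reg → Option Reg × Bool) × Option β)

/-- The equalities between registers. -/
def eqFlags {R : Type} (v : R → ℕ) : R → R → Bool := fun r s => decide (v r = v s)

/-- The value described by a register operation. -/
def opVal {R : Type} (v : R → ℕ) (o : Option R × Bool) : ℕ := o.1.elim 0 v + o.2.toNat

namespace RegMachine

variable {α β : Type}

/-- A configuration of a register machine. -/
structure Cfg (R : RegMachine α β) where
  state : R.State
  inPos : ℕ
  reg : R.Reg → ℕ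
  output : List β

/-- The start configuration. -/
def init (R : RegMachine α β) : Cfg R := ⟨R.start, 0, fun _ => 0, []⟩

/-- One step of a register machine. -/
def next (R : RegMachine α β) (x : List α) (c : Cfg R) : Option (Cfg R) :=
  (R.trans c.state (Machine.readInput x c.inPos) (eqFlags c.reg)).map fun t =>
    { state := t.1
      inPos := Machine.moveInput x.length c.inPos t.2.1
      reg := fun r => opVal c.reg (t.2.2.1 r)
      output := c.output ++ t.2.2.2.toList }

/-! ## Simulation of register machines by log-space machines -/

/-- The control states of the simulating machine. -/
inductive Phase (R : RegMachine α β)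
  | boot
  | ready (q : R.State) (e : R.Reg → R.Reg → Bool)
  | sweep (q : R.State) (src : R.Reg → Option R.Reg) (carry : R.Reg → Bool)
      (e : R.Reg → R.Reg → Bool)
  | back (q : R.State) (e : R.Reg → R.Reg → Bool)

theorem finite_phase (R : RegMachine α β) : Finite (Phase R) := by
  have := R.finiteState
  have := R.finiteReg
  let S := Unit ⊕ (R.State × (R.Reg → R.Reg → Bool)) ⊕
    (R.State × (R.Reg → Option R.Reg) × (R.Reg → Bool) × (R.Reg → R.Reg → Bool)) ⊕
    (R.State × (R.Reg → R.Reg → Bool))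
  let f : S → Phase R := fun s => match s with
    | .inl _ => .boot
    | .inr (.inl p) => .ready p.1 p.2
    | .inr (.inr (.inl p)) => .sweep p.1 p.2.1 p.2.2.1 p.2.2.2
    | .inr (.inr (.inr p)) => .back p.1 p.2
  refine Finite.of_surjective f ?_
  rintro (_ | ⟨q, e⟩ | ⟨q, s, c, e⟩ | ⟨q, e⟩)
  · exact ⟨.inl (), rfl⟩
  · exact ⟨.inr (.inl (q, e)), rfl⟩
  · exact ⟨.inr (.inr (.inl (q, s, c, e))), rfl⟩
  · exact ⟨.inr (.inr (.inr (q, e))), rfl⟩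

/-- The work alphabet of the simulating machine: a cell holds one binary digit of every
register. -/
inductive Cell (I : Type)
  | blank
  | marker
  | col (b : I → Bool)

theorem finite_cell (I : Type) [Finite I] : Finite (Cell I) := by
  let f : Option (Option (I → Bool)) → Cell I := fun s => match s with
    | none => .blank
    | some none => .marker
    | some (some b) => .col b
  refine Finite.of_surjective f ?_
  rintro (_ | _ | b)
  exacts [⟨none, rfl⟩, ⟨some none, rfl⟩, ⟨some (some b), rfl⟩]

open Classical in
/-- The column with which the number is prolonged when the carries `c` leave it. -/
noncomputable def topCell {I : Type} (c : I → Bool) : Cell I :=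
  if ∃ r, c r = true then .col c else .blank

/-- The digit of the source register. -/
def srcBit {I : Type} (b : I → Bool) (src : I → Option I) (r : I) : Bool := (src r).elim false b

/-- The transitions of the simulating machine. -/
noncomputable def simTrans (R : RegMachine α β) (p : Phase R) (a : InSym α) (w : Cell R.Reg) :
    Option (Phase R × Move × (Cell R.Reg × Move) × Option β) :=
  match p with
  | .boot => some (.ready R.start fun _ _ => true, .stay, (.marker, .stay), none)
  | .ready q e => (R.trans q a e).map fun t =>
      (.sweep t.1 (fun r => (t.2.2.1 r).1) (fun r => (t.2.2.1 r).2) fun _ _ => true,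
        t.2.1, (w, .right), t.2.2.2)
  | .sweep q src c e => match w with
    | .col b => some
        (.sweep q src (fun r => srcBit b src r && c r)
          (fun r s => e r s && ((srcBit b src r ^^ c r) == (srcBit b src s ^^ c s))),
          .stay, (.col fun r => srcBit b src r ^^ c r, .right), none)
    | _ => some (.back q fun r s => e r s && (c r == c s), .stay, (topCell c, .left), none)
  | .back q e => match w with
    | .marker => some (.ready q e, .stay, (.marker, .stay), none)
    | w => some (.back q e, .stay, (w, .left), none)

/-- The simulating machine: its only work tape holds the binary digits of all registers, least
significant digits first. -/
noncomputable def sim (R : RegMachine α β) : Machine α β where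
  State := Phase R
  finiteState := finite_phase R
  WorkSym := Cell R.Reg
  finiteWorkSym := have := R.finiteReg; finite_cell R.Reg
  blank := .blank
  tapes := 1
  start := .boot
  trans p a w := (simTrans R p a (w 0)).map fun t => (t.1, t.2.1, fun _ => t.2.2.1, t.2.2.2)

/-- A configuration of the simulating machine. -/
def simCfg (R : RegMachine α β) (p : Phase R) (h wp : ℕ) (w : ℕ → Cell R.Reg) (out : List β) :
    Machine.Cfg (sim R) :=
  ⟨p, h, fun _ => wp, fun _ => w, out⟩

theorem next_simCfg (R : RegMachine α β) (x : List α) (p : Phase R) (h wp : ℕ)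
    (w : ℕ → Cell R.Reg) (out : List β) :
    (sim R).next x (simCfg R p h wp w out) =
      (simTrans R p (Machine.readInput x h) (w wp)).map fun t =>
        simCfg R t.1 (Machine.moveInput x.length h t.2.1) (Machine.moveWork wp t.2.2.1.2)
          (Function.update w wp t.2.2.1.1) (out ++ t.2.2.2.toList) := by
  simp only [Machine.next, sim, simCfg, Option.map_map]
  rfl

/-- The tape that holds `W` digits of the numbers `v`. -/
def tapeOf {I : Type} (W : ℕ) (v : I → ℕ) : ℕ → Cell I
  | 0 => .marker
  | t + 1 => if t < W then .col fun r => (v r).testBit t else .blank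

/-- The carry into digit `t` when `i` is added to `b`. -/
def carry (b : ℕ) (i : Bool) (t : ℕ) : Bool := decide (2 ^ t ≤ b % 2 ^ t + i.toNat)

/-! ### Binary arithmetic, one digit at a time -/

theorem mod_two_pow_succ (b t : ℕ) :
    b % 2 ^ (t + 1) = b % 2 ^ t + 2 ^ t * (b.testBit t).toNat := by
  rw [Nat.testBit_eq_decide_div_mod_eq, pow_succ, Nat.mod_mul]
  rcases Nat.mod_two_eq_zero_or_one (b / 2 ^ t) with h | h <;> simp [h]

theorem carry_zero (b : ℕ) (i : Bool) : carry b i 0 = i := by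
  cases i <;> simp [carry, Nat.mod_one]

/-- Since at most one is added, a carry leaves digit `t` exactly when the digit is 1 and a carry
enters it. Finite control can therefore propagate it. -/
theorem carry_succ (b : ℕ) (i : Bool) (t : ℕ) :
    carry b i (t + 1) = (b.testBit t && carry b i t) := by
  have h := Nat.mod_lt b (Nat.two_pow_pos t)
  have hi : i.toNat ≤ 1 := Bool.toNat_le i
  rw [carry, carry, mod_two_pow_succ, pow_succ]
  cases b.testBit t <;> simp <;> omega

/-- Dividing `b + i` by `2 ^ t` gives `b / 2 ^ t` plus the carry into digit `t`; the parity of this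
sum is the exclusive or. -/
theorem testBit_add_toNat (b : ℕ) (i : Bool) (t : ℕ) :
    (b + i.toNat).testBit t = (b.testBit t ^^ carry b i t) := by
  have h := Nat.mod_lt b (Nat.two_pow_pos t)
  have hi : i.toNat ≤ 1 := Bool.toNat_le i
  have hp := Nat.two_pow_pos t
  have hb := Nat.div_add_mod b (2 ^ t)
  have key : (b + i.toNat) / 2 ^ t = b / 2 ^ t + (carry b i t).toNat := by
    rw [Nat.div_eq_iff hp]
    rw [carry]
    by_cases hc : 2 ^ t ≤ b % 2 ^ t + i.toNat
    · simp only [hc, decide_true, Bool.toNat_true, Nat.add_mul, Nat.mul_comm (b / 2 ^ t)]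
      omega
    · simp only [hc, decide_false, Bool.toNat_false, Nat.add_mul, Nat.mul_comm (b / 2 ^ t)]
      omega
  rw [Nat.testBit_eq_decide_div_mod_eq, Nat.testBit_eq_decide_div_mod_eq, key]
  cases carry b i t <;> rcases Nat.mod_two_eq_zero_or_one (b / 2 ^ t) with h | h <;>
    simp [h, Nat.add_mod]

theorem lt_two_pow_of_carry (b : ℕ) (i : Bool) (t : ℕ) (hb : b < 2 ^ t) :
    carry b i t = false ↔ b + i.toNat < 2 ^ t := by
  rw [carry, Nat.mod_eq_of_lt hb]
  simp

/-- Equality modulo `2 ^ t` is updated from one digit to the next by a single comparison, so the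
equality flags of all registers can be recomputed while their digits are rewritten. -/
theorem decide_mod_succ (n m t : ℕ) :
    decide (n % 2 ^ (t + 1) = m % 2 ^ (t + 1)) =
      (decide (n % 2 ^ t = m % 2 ^ t) && (n.testBit t == m.testBit t)) := by
  have h := Nat.mod_lt n (Nat.two_pow_pos t)
  have h' := Nat.mod_lt m (Nat.two_pow_pos t)
  rw [mod_two_pow_succ, mod_two_pow_succ]
  cases n.testBit t <;> cases m.testBit t <;> simp <;> omega

/-! ### Simulating one register step by a sweep over the work tape -/

section sweep

variable (R : RegMachine α β) (x : List α) (S : ℕ)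

/-- At most `S` work cells are in use. -/
def Narrow (c : Machine.Cfg (sim R)) : Prop := ∀ i, c.workPos i + 1 ≤ S

theorem narrow_simCfg {p : Phase R} {h wp : ℕ} {w : ℕ → Cell R.Reg} {out : List β}
    (hw : wp + 1 ≤ S) : Narrow R S (simCfg R p h wp w out) := fun _ => hw

variable {R} (v : R.Reg → ℕ) (op : R.Reg → Option R.Reg × Bool)

/-- The tape during a sweep: the first `t` digits have been replaced. -/
def mixTape (W t : ℕ) : ℕ → Cell R.Reg := fun c =>
  if c ≤ t then tapeOf W (fun r => opVal v (op r)) c else tapeOf W v c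

/-- The control state during a sweep. -/
def sweepPhase (q : R.State) (t : ℕ) : Phase R :=
  .sweep q (fun r => (op r).1) (fun r => carry ((op r).1.elim 0 v) (op r).2 t)
    fun r s => decide (opVal v (op r) % 2 ^ t = opVal v (op s) % 2 ^ t)

theorem srcBit_testBit (t : ℕ) (r : R.Reg) :
    srcBit (fun r => (v r).testBit t) (fun r => (op r).1) r = ((op r).1.elim 0 v).testBit t := by
  cases h : (op r).1 <;> simp [srcBit, h]

/-- Cell `t + 1` holds digit `t`, cell 0 being the marker. The control state carries exactly what is
needed there: the carries into digit `t` and the equalities of the new values modulo `2 ^ t`. -/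
theorem sweep_step (q : R.State) (W t h : ℕ) (out : List β) (ht : t < W) :
    (sim R).next x (simCfg R (sweepPhase v op q t) h (t + 1) (mixTape v op W t) out) =
      some (simCfg R (sweepPhase v op q (t + 1)) h (t + 2) (mixTape v op W (t + 1)) out) := by
  have hcell : mixTape v op W t (t + 1) = .col fun r => (v r).testBit t := by
    simp [mixTape, tapeOf, ht]
  have hnew : ∀ r, (((op r).1.elim 0 v).testBit t ^^
      carry ((op r).1.elim 0 v) (op r).2 t) = (opVal v (op r)).testBit t := by
    intro r
    rw [opVal, testBit_add_toNat]
  rw [next_simCfg, hcell]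
  simp only [sweepPhase, simTrans, Option.map_some, srcBit_testBit, hnew, Machine.moveInput,
    Machine.moveWork, Option.toList_none, List.append_nil]
  congr 2
  · simp only [carry_succ, decide_mod_succ]
  · funext c
    by_cases hc : c = t + 1
    · subst hc
      simp [mixTape, tapeOf, ht]
    · rw [Function.update_of_ne hc, mixTape, mixTape]
      have : c ≤ t ↔ c ≤ t + 1 := by omega
      simp [this]

theorem sweep_run (q : R.State) (W h : ℕ) (out : List β) (hS : W + 2 ≤ S) (t : ℕ) (ht : t ≤ W) :
    RunIn ((sim R).next x) (Narrow R S)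
      (simCfg R (sweepPhase v op q 0) h 1 (tapeOf W v) out)
      (simCfg R (sweepPhase v op q t) h (t + 1) (mixTape v op W t) out) := by
  induction t with
  | zero =>
    have : mixTape v op W 0 = tapeOf W v := by
      funext c
      rcases c with _ | c <;> simp [mixTape, tapeOf]
    rw [this]
    exact RunIn.refl _
  | succ t ih =>
    exact (ih (by omega)).trans
      (RunIn.single (narrow_simCfg R S (by omega)) (sweep_step x v op q W t h out (by omega)))

theorem back_run (q : R.State) (e : R.Reg → R.Reg → Bool) (W h t : ℕ) (out : List β)
    (hS : t + 1 ≤ S) (ht : t ≤ W) :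
    RunIn ((sim R).next x) (Narrow R S) (simCfg R (.back q e) h t (tapeOf W v) out)
      (simCfg R (.ready q e) h 0 (tapeOf W v) out) := by
  induction t with
  | zero =>
    refine RunIn.single (narrow_simCfg R S hS) ?_
    have h0 : tapeOf W v 0 = .marker := rfl
    rw [next_simCfg, h0]
    simp only [simTrans, Option.map_some, Machine.moveInput, Machine.moveWork, Option.toList_none,
      List.append_nil]
    rw [← h0, Function.update_eq_self]
  | succ t ih =>
    refine (RunIn.single (narrow_simCfg R S hS) ?_).trans (ih (by omega) (by omega))
    have h0 : tapeOf W v (t + 1) = .col fun r => (v r).testBit t := by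
      simp [tapeOf, show t < W by omega]
    rw [next_simCfg, h0]
    simp only [simTrans, Option.map_some, Machine.moveInput, Machine.moveWork, Option.toList_none,
      List.append_nil]
    rw [← h0, Function.update_eq_self]
    rfl

/-- The configuration of the simulating machine between two simulated steps. -/
def readyCfg (c : Cfg R) (W : ℕ) : Machine.Cfg (sim R) :=
  simCfg R (.ready c.state (eqFlags c.reg)) c.inPos 0 (tapeOf W c.reg) c.output

/-- This is the source of the space bound. A column is added only if a carry leaves some register;
then its new value is at least `2 ^ W`, and since values are at most `B`, the new width `W + 1` is
at most `Nat.log 2 B + 1`. -/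
theorem top_step (q : R.State) (W B h : ℕ) (out : List β) (hS : Nat.log 2 B + 3 ≤ S)
    (hW : W ≤ Nat.log 2 B + 1) (hv : ∀ r, v r < 2 ^ W) (hB : ∀ r, opVal v (op r) ≤ B) :
    ∃ W', W' ≤ Nat.log 2 B + 1 ∧ (∀ r, opVal v (op r) < 2 ^ W') ∧
      RunIn ((sim R).next x) (Narrow R S)
        (simCfg R (sweepPhase v op q W) h (W + 1) (mixTape v op W W) out)
        (simCfg R (.ready q (eqFlags fun r => opVal v (op r))) h 0
          (tapeOf W' fun r => opVal v (op r)) out) := by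
  have hb : ∀ r, (op r).1.elim 0 v < 2 ^ W := by
    intro r
    cases (op r).1 with
    | none => simp
    | some s => exact hv s
  have hlt : ∀ r, opVal v (op r) < 2 ^ (W + 1) := by
    intro r
    have := hb r
    have hi : (op r).2.toNat ≤ 1 := Bool.toNat_le _
    have := Nat.two_pow_pos W
    rw [opVal, pow_succ]
    omega
  have htop : ∀ r, carry ((op r).1.elim 0 v) (op r).2 W = (opVal v (op r)).testBit W := by
    intro r
    rw [opVal, testBit_add_toNat, Nat.testBit_lt_two_pow (hb r), Bool.false_xor]
  -- The outgoing carry is digit `W` of the new value, so the flags now compare `W + 1` digits,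
  -- which is all of them.
  have hflags : (fun r s => decide (opVal v (op r) % 2 ^ W = opVal v (op s) % 2 ^ W) &&
      (carry ((op r).1.elim 0 v) (op r).2 W == carry ((op s).1.elim 0 v) (op s).2 W)) =
      eqFlags fun r => opVal v (op r) := by
    funext r s
    rw [htop, htop, ← decide_mod_succ, Nat.mod_eq_of_lt (hlt r), Nat.mod_eq_of_lt (hlt s)]
    rfl
  have hcell : mixTape v op W W (W + 1) = .blank := by simp [mixTape, tapeOf]
  have hstep : (sim R).next x
      (simCfg R (sweepPhase v op q W) h (W + 1) (mixTape v op W W) out) =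
      some (simCfg R (.back q (eqFlags fun r => opVal v (op r))) h W
        (Function.update (mixTape v op W W) (W + 1)
          (topCell fun r => carry ((op r).1.elim 0 v) (op r).2 W)) out) := by
    rw [next_simCfg, hcell]
    simp only [sweepPhase, simTrans, Option.map_some, hflags, Machine.moveInput,
      Machine.moveWork, Option.toList_none, List.append_nil, Nat.add_sub_cancel]
  by_cases hc : ∃ r, carry ((op r).1.elim 0 v) (op r).2 W = true
  · have htape : Function.update (mixTape v op W W) (W + 1)
        (topCell fun r => carry ((op r).1.elim 0 v) (op r).2 W) =
        tapeOf (W + 1) fun r => opVal v (op r) := by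
      funext c
      rw [topCell, if_pos hc]
      by_cases hc : c = W + 1
      · subst hc
        simp [tapeOf, htop]
      · rw [Function.update_of_ne hc, mixTape]
        rcases c with _ | c
        · simp [tapeOf]
        · by_cases hcW : c < W
          · simp [tapeOf, hcW, show c + 1 ≤ W by omega, show c < W + 1 by omega]
          · simp [tapeOf, hcW, show ¬ c < W + 1 by omega]
    have hW' : W + 1 ≤ Nat.log 2 B + 1 := by
      obtain ⟨r, hr⟩ := hc
      have h1 : 2 ^ W ≤ opVal v (op r) := by
        by_contra hlt
        rw [opVal, not_le, ← lt_two_pow_of_carry _ _ _ (hb r)] at hlt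
        simp [hlt] at hr
      have h2 := h1.trans (hB r)
      have := Nat.le_log_of_pow_le (by norm_num) h2
      omega
    refine ⟨W + 1, hW', hlt, (RunIn.single (narrow_simCfg R S (by omega)) hstep).trans ?_⟩
    rw [htape]
    exact back_run x S _ q _ (W + 1) h W out (by omega) (by omega)
  · have htape : Function.update (mixTape v op W W) (W + 1)
        (topCell fun r => carry ((op r).1.elim 0 v) (op r).2 W) =
        tapeOf W fun r => opVal v (op r) := by
      funext c
      rw [topCell, if_neg hc]
      by_cases hc : c = W + 1
      · subst hc
        simp [tapeOf]
      · rw [Function.update_of_ne hc, mixTape]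
        rcases c with _ | c
        · simp [tapeOf]
        · by_cases hcW : c < W
          · simp [tapeOf, hcW, show c + 1 ≤ W by omega]
          · simp [tapeOf, hcW]
    refine ⟨W, hW, fun r => ?_, (RunIn.single (narrow_simCfg R S (by omega)) hstep).trans ?_⟩
    · rw [opVal, ← lt_two_pow_of_carry _ _ _ (hb r)]
      simpa using fun h => hc ⟨r, h⟩
    · rw [htape]
      exact back_run x S _ q _ W h W out (by omega) le_rfl

theorem sim_step (c c' : Cfg R) (W B : ℕ) (hS : Nat.log 2 B + 3 ≤ S) (hW : W ≤ Nat.log 2 B + 1)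
    (hv : ∀ r, c.reg r < 2 ^ W) (hB : ∀ r, c'.reg r ≤ B) (hstep : R.next x c = some c') :
    ∃ W', W' ≤ Nat.log 2 B + 1 ∧ (∀ r, c'.reg r < 2 ^ W') ∧
      RunIn ((sim R).next x) (Narrow R S) (readyCfg c W) (readyCfg c' W') := by
  rw [next, Option.map_eq_some_iff] at hstep
  obtain ⟨t, ht, rfl⟩ := hstep
  obtain ⟨W', h1, h2, h3⟩ := top_step x S c.reg t.2.2.1 t.1 W B
    (Machine.moveInput x.length c.inPos t.2.1) (c.output ++ t.2.2.2.toList) hS hW hv hB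
  refine ⟨W', h1, h2, ?_⟩
  refine (RunIn.single (narrow_simCfg R S (by omega)) ?_).trans
    ((sweep_run x S c.reg t.2.2.1 t.1 W (Machine.moveInput x.length c.inPos t.2.1)
      (c.output ++ t.2.2.2.toList) (by omega) W le_rfl).trans h3)
  rw [next_simCfg]
  simp only [simTrans, ht, Option.map_some, Machine.moveWork, Function.update_eq_self]
  simp [sweepPhase, carry_zero, Nat.mod_one]

end sweep

/-- All registers hold at most `B`. -/
def Bounded (R : RegMachine α β) (B : ℕ) (c : Cfg R) : Prop := ∀ r, c.reg r ≤ B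

theorem sim_run (R : RegMachine α β) (x : List α) (S B : ℕ) (hS : Nat.log 2 B + 3 ≤ S)
    (c : Cfg R) (hrun : RunIn (R.next x) (R.Bounded B) R.init c) (hc : R.Bounded B c) :
    ∃ W, W ≤ Nat.log 2 B + 1 ∧ (∀ r, c.reg r < 2 ^ W) ∧
      RunIn ((sim R).next x) (Narrow R S) (sim R).init (readyCfg c W) := by
  induction hrun with
  | refl =>
    -- Zero digits already represent registers that are all 0, so booting only writes the marker and
    -- sets every equality flag to true.
    refine ⟨0, by omega, by simp [init], RunIn.single (narrow_simCfg R S (by omega)) ?_⟩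
    change (sim R).next x (simCfg R .boot 0 0 (fun _ => .blank) []) = _
    rw [next_simCfg]
    simp only [simTrans, Option.map_some, Machine.moveInput, Machine.moveWork, Option.toList_none,
      List.append_nil, readyCfg, init]
    congr 2
    funext t
    rcases t with _ | t <;> simp [tapeOf]
  | tail _ hstep ih =>
    obtain ⟨W, h1, h2, h3⟩ := ih hstep.1
    obtain ⟨W', h1', h2', h3'⟩ := sim_step x S _ _ W B hS h1 h2 hc hstep.2
    exact ⟨W', h1', h2', h3.trans h3'⟩

theorem log_succ_le (n : ℕ) : Nat.log 2 (n + 1) ≤ Nat.log 2 n + 1 := by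
  rcases Nat.eq_zero_or_pos n with rfl | hn
  · simp
  · calc Nat.log 2 (n + 1) ≤ Nat.log 2 (n * 2) := Nat.log_mono_right (by omega)
      _ = Nat.log 2 n + 1 := Nat.log_mul_base (by norm_num) (by omega)

/-- A polynomially bounded function that is computed by a register machine whose registers never
exceed the length of the input by more than one is in FL. -/
theorem fl_of_run (R : RegMachine α β) (f : List α → List β)
    (hlen : ∃ e : ℕ, ∀ x, (f x).length ≤ x.length ^ e + e)
    (hrun : ∀ x, ∃ c, RunIn (R.next x) (R.Bounded (x.length + 1)) R.init c ∧
      R.Bounded (x.length + 1) c ∧ R.next x c = none ∧ c.output = f x) : FL f := by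
  -- With `B = |x| + 1`, the marker, up to `Nat.log 2 B + 1` digits and the blank behind them take
  -- `Nat.log 2 B + 3` cells; replacing `|x| + 1` by `|x|` in the logarithm costs one more.
  refine ⟨hlen, sim R, 1, 4, ?_⟩
  have key : ∀ x, ∃ c, RunIn ((sim R).next x) (Narrow R (1 * Nat.log 2 x.length + 4))
      (sim R).init c ∧ Narrow R (1 * Nat.log 2 x.length + 4) c ∧ (sim R).next x c = none ∧
      c.output = f x := by
    intro x
    obtain ⟨c, h1, h2, h3, h4⟩ := hrun x
    have hlog := log_succ_le x.length
    obtain ⟨W, -, -, hW⟩ := sim_run R x (1 * Nat.log 2 x.length + 4) (x.length + 1) (by omega)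
      c h1 h2
    refine ⟨_, hW, narrow_simCfg R _ (by omega), ?_, h4⟩
    rw [next, Option.map_eq_none_iff] at h3
    rw [readyCfg, next_simCfg]
    simp [simTrans, h3]
  constructor
  · intro x
    obtain ⟨c, h1, -, h3, h4⟩ := key x
    exact ⟨c, h1.reaches, h3, h4⟩
  · intro x d hd
    obtain ⟨c, h1, h2, h3, -⟩ := key x
    exact h1.good_of_reaches h2 h3 hd

end RegMachine

/-! ## A structured programming language for FL -/

/-- Programs with finite memory `σ` and registers `I` that hold positions of the input tape.
`act i g` reads the input symbol at the position in register `i`, changes the memory, replaces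
every register by another one, possibly plus one, and possibly writes an output letter; `loop i p`
runs `p` for all values of register `i` from the left to the right end marker. -/
inductive Prog (α β I σ : Type)
  | act (i : I) (g : σ → InSym α → (I → I → Bool) → σ × (I → I × Bool) × Option β)
  | seq (p q : Prog α β I σ)
  | loop (i : I) (p : Prog α β I σ)

/-- The state of the computation of a program. -/
structure St (β I σ : Type) where
  mem : σ
  reg : I → ℕ
  out : List β

/-- Put a value into a register. -/
def St.setReg {β I σ : Type} [DecidableEq I] (s : St β I σ) (i : I) (t : ℕ) : St β I σ :=
  { s with reg := Function.update s.reg i t }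

/-- All registers hold at most `B`. -/
def St.Bounded {β I σ : Type} (B : ℕ) (s : St β I σ) : Prop := ∀ i, s.reg i ≤ B

namespace Prog

variable {α β I σ : Type}

/-- The effect of a program on input `x`. -/
def eval [DecidableEq I] (x : List α) : Prog α β I σ → St β I σ → St β I σ
  | act i g, s =>
    let t := g s.mem (Machine.readInput x (s.reg i)) (eqFlags s.reg)
    ⟨t.1, fun r => s.reg (t.2.1 r).1 + (t.2.1 r).2.toNat, s.out ++ t.2.2.toList⟩
  | seq p q, s => eval x q (eval x p s)
  | loop i p, s => (List.range (x.length + 2)).foldl (fun s t => eval x p (s.setReg i t)) s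

/-- The program does not change register `i`. -/
def Keeps (i : I) : Prog α β I σ → Prop
  | act _ g => ∀ m a e, (g m a e).2.1 i = (i, false)
  | seq p q => p.Keeps i ∧ q.Keeps i
  | loop j p => i ≠ j ∧ p.Keeps i

/-- No register is moved beyond the right end marker, and the body of a loop does not change the
register of the loop. -/
def WellFormed : Prog α β I σ → Prop
  | act i g => ∀ m a e r, ((g m a e).2.1 r).2 = true →
      ((g m a e).2.1 r).1 = i ∧ a ≠ InSym.rightEnd
  | seq p q => p.WellFormed ∧ q.WellFormed
  | loop i p => p.Keeps i ∧ p.WellFormed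

theorem readInput_eq_rightEnd (x : List α) (t : ℕ) :
    Machine.readInput x t = InSym.rightEnd ↔ x.length + 1 ≤ t := by
  rcases t with _ | t
  · simp [Machine.readInput]
  · rw [Machine.readInput]
    rcases lt_or_ge t x.length with h | h
    · simp [List.getElem?_eq_getElem h]
      omega
    · simp [h]

/-- Induction along a loop. -/
theorem loop_induction [DecidableEq I] (x : List α) (i : I) (p : Prog α β I σ)
    (P : ℕ → St β I σ → Prop) (s : St β I σ) (h0 : P 0 s)
    (hstep : ∀ t s, t ≤ x.length + 1 → P t s → P (t + 1) (eval x p (s.setReg i t))) :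
    P (x.length + 2) (eval x (loop i p) s) := by
  have key : ∀ t, t ≤ x.length + 2 →
      P t ((List.range t).foldl (fun s t => eval x p (s.setReg i t)) s) := by
    intro t ht
    induction t with
    | zero => exact h0
    | succ t ih =>
      rw [List.range_succ, List.foldl_append]
      exact hstep t _ (by omega) (ih (by omega))
  exact key _ le_rfl

theorem eval_keeps [DecidableEq I] (x : List α) (i : I) (p : Prog α β I σ) (hp : p.Keeps i)
    (s : St β I σ) : (eval x p s).reg i = s.reg i := by
  induction p generalizing s with
  | act j g => simp [eval, hp _ _ _]
  | seq p q ihp ihq => rw [eval, ihq hp.2, ihp hp.1]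
  | loop j p ih =>
    refine loop_induction x j p (fun _ s' => s'.reg i = s.reg i) s rfl fun t s' _ h => ?_
    rw [ih hp.2, ← h]
    exact Function.update_of_ne hp.1 _ _

theorem bounded_setReg [DecidableEq I] {B : ℕ} {s : St β I σ} (hs : s.Bounded B) (i : I) {t : ℕ}
    (ht : t ≤ B) : (s.setReg i t).Bounded B := by
  intro r
  by_cases h : r = i
  · subst h
    simpa [St.setReg] using ht
  · simpa [St.setReg, Function.update_of_ne h] using hs r

/-- An increment is only ever applied to the position just read, and only when the symbol there is
not the right end marker, so that position is at most `|x|`. -/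
theorem eval_bounded [DecidableEq I] (x : List α) (p : Prog α β I σ) (hp : p.WellFormed)
    (s : St β I σ) (hs : s.Bounded (x.length + 1)) :
    (eval x p s).Bounded (x.length + 1) := by
  induction p generalizing s with
  | act i g =>
    intro r
    simp only [eval]
    set t := g s.mem (Machine.readInput x (s.reg i)) (eqFlags s.reg) with htdef
    cases hr : (t.2.1 r).2 with
    | false => simpa using hs _
    | true =>
      obtain ⟨h1, h2⟩ := hp _ _ _ r hr
      rw [Ne, readInput_eq_rightEnd] at h2
      rw [← htdef] at h1
      rw [h1]
      simp only [Bool.toNat_true]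
      omega
  | seq p q ihp ihq => exact ihq hp.2 _ (ihp hp.1 _ hs)
  | loop i p ih =>
    exact loop_induction x i p (fun _ s' => s'.Bounded (x.length + 1)) s hs
      fun t s' ht h => ih hp.2 _ (bounded_setReg h i ht)

/-! ### The length of the output -/

/-- The number of actions of a program on inputs of length `n`. -/
def cost (n : ℕ) : Prog α β I σ → ℕ
  | act _ _ => 1
  | seq p q => p.cost n + q.cost n
  | loop _ p => (n + 2) * p.cost n

theorem length_out_le [DecidableEq I] (x : List α) (p : Prog α β I σ) (s : St β I σ) :
    (eval x p s).out.length ≤ s.out.length + p.cost x.length := by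
  induction p generalizing s with
  | act i g =>
    simp only [eval, cost, List.length_append, add_le_add_iff_left]
    exact Option.length_toList_le
  | seq p q ihp ihq =>
    have h1 := ihp s
    have h2 := ihq (eval x p s)
    simp only [eval, cost]
    omega
  | loop i p ih =>
    refine loop_induction x i p
      (fun t s' => s'.out.length ≤ s.out.length + t * p.cost x.length) s (by simp) ?_
    intro t s' _ h
    have h1 := ih (s'.setReg i t)
    have h2 : (s'.setReg i t).out = s'.out := rfl
    rw [h2] at h1
    rw [Nat.add_mul]
    omega

/-- Each level of loop nesting multiplies the number of actions by `n + 2`, which raises the degree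
by one. -/
theorem exists_cost_le (p : Prog α β I σ) : ∃ C d : ℕ, ∀ n, p.cost n ≤ C * (n + 2) ^ d := by
  induction p with
  | act i g => exact ⟨1, 0, fun n => by simp [cost]⟩
  | seq p q ihp ihq =>
    obtain ⟨C, d, h⟩ := ihp
    obtain ⟨C', d', h'⟩ := ihq
    refine ⟨C + C', max d d', fun n => ?_⟩
    rw [cost, Nat.add_mul]
    refine add_le_add ((h n).trans ?_) ((h' n).trans ?_)
    · exact Nat.mul_le_mul_left _ (Nat.pow_le_pow_right (by omega) (le_max_left _ _))
    · exact Nat.mul_le_mul_left _ (Nat.pow_le_pow_right (by omega) (le_max_right _ _))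
  | loop i p ih =>
    obtain ⟨C, d, h⟩ := ih
    refine ⟨C, d + 1, fun n => ?_⟩
    rw [cost, pow_succ, ← Nat.mul_assoc, Nat.mul_comm]
    exact Nat.mul_le_mul_right _ (h n)

theorem poly_le_pow_add (C d : ℕ) : ∃ e : ℕ, ∀ n, C * (n + 2) ^ d ≤ n ^ e + e := by
  -- For `n ≥ 2`, the factor `(n + 2) ^ d` is at most `n ^ (2 * d)` and `C` is at most `n ^ C`; the
  -- summand `C * 3 ^ d` covers `n = 0` and `n = 1`.
  refine ⟨2 * d + C + C * 3 ^ d, fun n => ?_⟩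
  rcases Nat.lt_or_ge n 2 with hn | hn
  · have : (n + 2) ^ d ≤ 3 ^ d := Nat.pow_le_pow_left (by omega) d
    have := Nat.mul_le_mul_left C this
    omega
  · have h1 : (n + 2) ^ d ≤ n ^ (2 * d) := by
      rw [pow_mul]
      exact Nat.pow_le_pow_left (by nlinarith) d
    have h2 : C ≤ n ^ C := (Nat.lt_pow_self (by omega)).le
    calc C * (n + 2) ^ d ≤ n ^ C * n ^ (2 * d) := Nat.mul_le_mul h2 h1
      _ = n ^ (2 * d + C) := by rw [← pow_add, Nat.add_comm]
      _ ≤ n ^ (2 * d + C + C * 3 ^ d) := Nat.pow_le_pow_right (by omega) (by omega)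
      _ ≤ _ := Nat.le_add_right _ _

/-! ### Compilation to register machines -/

/-- The control points of a program: rewinding the input head (`false`) and walking to the wanted
position (`true`), for actions and for the tests at the end of loop bodies; `none` is the start of
a loop. -/
def Point : Prog α β I σ → Type
  | act _ _ => Bool
  | seq p q => p.Point ⊕ q.Point
  | loop _ p => p.Point ⊕ Option Bool

theorem finite_point (p : Prog α β I σ) : Finite p.Point := by
  induction p with
  | act i g => exact inferInstanceAs (Finite Bool)
  | seq p q ihp ihq => exact inferInstanceAs (Finite (p.Point ⊕ q.Point))
  | loop i p ih => exact inferInstanceAs (Finite (p.Point ⊕ Option Bool))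

/-- The control point at which a program starts. -/
def entry : (p : Prog α β I σ) → p.Point
  | act _ _ => false
  | seq p _ => Sum.inl p.entry
  | loop _ _ => Sum.inr none

/-- What a transition yields: the new control point, the new memory, the move of the input head,
the operations on the registers (`none` is the register that holds the position of the input
head), and the output. -/
abbrev Outcome (Q β I σ : Type) : Type :=
  Q × σ × Move × (Option I → Option (Option I) × Bool) × Option β

/-- The operation that keeps all registers. -/
def keepOp (r : Option I) : Option (Option I) × Bool := (some r, false)

open Classical in
/-- The operation that clears register `i`. -/
noncomputable def clearOp (i r : Option I) : Option (Option I) × Bool :=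
  if r = i then (none, false) else (some r, false)

open Classical in
/-- The operation that increments register `i`. -/
noncomputable def incOp (i r : Option I) : Option (Option I) × Bool := (some r, decide (r = i))

/-- The operation of an action. -/
def actOp (f : I → I × Bool) : Option I → Option (Option I) × Bool
  | none => (some none, false)
  | some r => (some (some (f r).1), (f r).2)

/-- Rewinding the input head. -/
noncomputable def rewindStep {Q : Type} (q q' : Q) (m : σ) : InSym α → Outcome Q β I σ
  | .leftEnd => (q', m, .stay, clearOp none, none)
  | _ => (q, m, .left, keepOp, none)

/-- Walking to the wanted position. -/
noncomputable def walkStep {Q : Type} (q : Q) (m : σ) : Outcome Q β I σ :=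
  (q, m, .right, incOp none, none)

/-- The transitions of a program; the control point `none` is the end of the program. -/
noncomputable def trans : (p : Prog α β I σ) → p.Point → σ → InSym α →
    (Option I → Option I → Bool) → Outcome (Option p.Point) β I σ
  | act _ _, false, m, a, _ => rewindStep (some false) (some true) m a
  | act i g, true, m, a, e =>
    if e none (some i) then
      let t := g m a fun r s => e (some r) (some s)
      (none, t.1, .stay, actOp t.2.1, t.2.2)
    else walkStep (some true) m
  | seq p q, Sum.inl c, m, a, e =>
    let t := p.trans c m a e
    (some (t.1.elim (Sum.inr q.entry) Sum.inl), t.2)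
  | seq _ q, Sum.inr c, m, a, e =>
    let t := q.trans c m a e
    (t.1.map Sum.inr, t.2)
  | loop _ p, Sum.inl c, m, a, e =>
    let t := p.trans c m a e
    (some (t.1.elim (Sum.inr (some false)) Sum.inl), t.2)
  | loop i p, Sum.inr none, m, _, _ =>
    (some (Sum.inl p.entry), m, .stay, clearOp (some i), none)
  | loop _ _, Sum.inr (some false), m, a, _ =>
    rewindStep (some (Sum.inr (some false))) (some (Sum.inr (some true))) m a
  | loop i p, Sum.inr (some true), m, a, e =>
    if e none (some i) then
      match a with
      | .rightEnd => (none, m, .stay, keepOp, none)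
      | _ => (some (Sum.inl p.entry), m, .stay, incOp (some i), none)
    else walkStep (some (Sum.inr (some true))) m

/-- The register machine given by control points, transitions, and start values. -/
def toReg [Finite σ] [Finite I] (Q : Type) [Finite Q]
    (T : Q → σ → InSym α → (Option I → Option I → Bool) → Option (Outcome Q β I σ))
    (q₀ : Q) (m₀ : σ) : RegMachine α β where
  State := Q × σ
  finiteState := inferInstance
  Reg := Option I
  finiteReg := inferInstance
  start := (q₀, m₀)
  trans q a e := (T q.1 q.2 a e).map fun t => ((t.1, t.2.1), t.2.2)

/-! ### Correctness of the compilation -/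

section compile

variable [Finite σ] [Finite I] {Q : Type} [Finite Q]
  (T : Q → σ → InSym α → (Option I → Option I → Bool) → Option (Outcome Q β I σ))
  (q₀ : Q) (m₀ : σ) (x : List α)

/-- The transitions `T` contain a copy of the program `p`, placed by `ι`, which continues at `e`
when it ends. -/
def Hosts (p : Prog α β I σ) (ι : p.Point → Q) (e : Q) : Prop :=
  ∀ c m a f, T (ι c) m a f = some ((p.trans c m a f).1.elim e ι, (p.trans c m a f).2)

/-- The configuration of the register machine with control point `q`, input head at `h`, and
`k` in the register for the position of the input head. -/
def regCfg (q : Q) (s : St β I σ) (h k : ℕ) : RegMachine.Cfg (toReg Q T q₀ m₀) :=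
  ⟨(q, s.mem), h, fun r => r.elim k s.reg, s.out⟩

/-- One step of the register machine. -/
theorem next_regCfg (q : Q) (s : St β I σ) (h k : ℕ) {t : Outcome Q β I σ}
    (ht : T q s.mem (Machine.readInput x h) (eqFlags fun r => r.elim k s.reg) = some t) :
    (toReg Q T q₀ m₀).next x (regCfg T q₀ m₀ q s h k) = some
      (regCfg T q₀ m₀ t.1
        ⟨t.2.1, fun r => opVal (fun r => r.elim k s.reg) (t.2.2.2.1 (some r)),
          s.out ++ t.2.2.2.2.toList⟩
        (Machine.moveInput x.length h t.2.2.1)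
        (opVal (fun r => r.elim k s.reg) (t.2.2.2.1 none))) := by
  have h1 : (toReg Q T q₀ m₀).trans (regCfg T q₀ m₀ q s h k).state
      (Machine.readInput x (regCfg T q₀ m₀ q s h k).inPos)
      (eqFlags (regCfg T q₀ m₀ q s h k).reg) = some ((t.1, t.2.1), t.2.2) := by
    change (T q s.mem (Machine.readInput x h) (eqFlags fun r => r.elim k s.reg)).map _ = _
    rw [ht]
    rfl
  refine (congrArg (Option.map _) h1).trans (congrArg some ?_)
  have hreg : (fun r => opVal (fun r => r.elim k s.reg) (t.2.2.2.1 r)) = fun r : Option I =>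
      r.elim (opVal (fun r => r.elim k s.reg) (t.2.2.2.1 none))
        fun r => opVal (fun r => r.elim k s.reg) (t.2.2.2.1 (some r)) := by
    funext r
    cases r <;> rfl
  exact congrArg (fun f => (⟨(t.1, t.2.1), Machine.moveInput x.length h t.2.2.1, f,
    s.out ++ t.2.2.2.2.toList⟩ : RegMachine.Cfg (toReg Q T q₀ m₀))) hreg

/-- Runs of the register machine through bounded configurations. -/
abbrev RegRun := RunIn ((toReg Q T q₀ m₀).next x)
  ((toReg Q T q₀ m₀).Bounded (x.length + 1))

theorem bounded_regCfg {q : Q} {s : St β I σ} {h k B : ℕ} (hs : s.Bounded B) (hk : k ≤ B) :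
    (toReg Q T q₀ m₀).Bounded B (regCfg T q₀ m₀ q s h k) := by
  rintro (_ | r)
  · exact hk
  · exact hs r

theorem readInput_ne_leftEnd (h : ℕ) : Machine.readInput x (h + 1) ≠ InSym.leftEnd := by
  rw [Machine.readInput]
  cases x[h]? <;> simp

/-- The head cannot jump to a stored position. It first returns to the left end, where the register
tracking it is cleared; that register may hold an arbitrary bounded value `k` until then. -/
theorem rewind_run (q q' : Q) (hT : ∀ m a e, T q m a e = some (rewindStep q q' m a))
    (s : St β I σ) (hs : s.Bounded (x.length + 1)) (h k : ℕ) (hk : k ≤ x.length + 1) :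
    RegRun T q₀ m₀ x (regCfg T q₀ m₀ q s h k) (regCfg T q₀ m₀ q' s 0 0) := by
  induction h with
  | zero =>
    refine RunIn.single (bounded_regCfg T q₀ m₀ hs hk) ?_
    rw [next_regCfg T q₀ m₀ x q s 0 k (hT _ _ _)]
    simp [rewindStep, Machine.readInput, clearOp, opVal, Machine.moveInput]
  | succ h ih =>
    refine (RunIn.single (bounded_regCfg T q₀ m₀ hs hk) ?_).trans ih
    have hstep : T q s.mem (Machine.readInput x (h + 1)) (eqFlags fun r => r.elim k s.reg) =
        some (q, s.mem, .left, keepOp, none) := by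
      rw [hT]
      have := readInput_ne_leftEnd x h
      cases ha : Machine.readInput x (h + 1) <;> simp_all [rewindStep]
    rw [next_regCfg T q₀ m₀ x q s (h + 1) k hstep]
    simp [keepOp, opVal, Machine.moveInput]

/-- Going right, the tracking register counts along with the head, so equality with register `i`
signals arrival. -/
theorem walk_run (q : Q) (i : I)
    (hT : ∀ m a e, e none (some i) = false → T q m a e = some (walkStep q m))
    (s : St β I σ) (hs : s.Bounded (x.length + 1)) (h : ℕ) (hh : h ≤ s.reg i) :
    RegRun T q₀ m₀ x (regCfg T q₀ m₀ q s 0 0) (regCfg T q₀ m₀ q s h h) := by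
  induction h with
  | zero => exact RunIn.refl _
  | succ h ih =>
    have hi := hs i
    refine (ih (by omega)).trans
      (RunIn.single (bounded_regCfg T q₀ m₀ hs (by omega)) ?_)
    rw [next_regCfg T q₀ m₀ x q s h h (hT _ _ _ ?_)]
    · simp only [walkStep, incOp, opVal, Machine.moveInput]
      rw [min_eq_left (show h + 1 ≤ x.length + 1 by omega)]
      simp
    · exact decide_eq_false (show h ≠ s.reg i by omega)

theorem fetch_run (q q' : Q) (i : I) (hT : ∀ m a e, T q m a e = some (rewindStep q q' m a))
    (hT' : ∀ m a e, e none (some i) = false → T q' m a e = some (walkStep q' m))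
    (s : St β I σ) (hs : s.Bounded (x.length + 1)) (h k : ℕ) (hk : k ≤ x.length + 1) :
    RegRun T q₀ m₀ x (regCfg T q₀ m₀ q s h k) (regCfg T q₀ m₀ q' s (s.reg i) (s.reg i)) :=
  (rewind_run T q₀ m₀ x q q' hT s hs h k hk).trans
    (walk_run T q₀ m₀ x q' i hT' s hs _ le_rfl)

/-- Induction on the program. The head position `h` and the tracking value `k` are left arbitrary
because every read rewinds first; consecutive programs therefore need no agreement about them. -/
theorem eval_run [DecidableEq I] (p : Prog α β I σ) (hp : p.WellFormed) (ι : p.Point → Q)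
    (e : Q) (hT : Hosts T p ι e) (s : St β I σ) (hs : s.Bounded (x.length + 1))
    (h k : ℕ) (hk : k ≤ x.length + 1) :
    ∃ h' k', k' ≤ x.length + 1 ∧
      RegRun T q₀ m₀ x (regCfg T q₀ m₀ (ι p.entry) s h k)
        (regCfg T q₀ m₀ e (eval x p s) h' k') := by
  induction p generalizing e s h k with
  | act i g =>
    refine ⟨s.reg i, s.reg i, hs i, ?_⟩
    refine (fetch_run T q₀ m₀ x (ι false) (ι true) i ?_ ?_ s hs h k hk).trans
      (RunIn.single (bounded_regCfg T q₀ m₀ hs (hs i)) ?_)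
    · intro m a f
      rw [hT false m a f]
      cases a <;> rfl
    · intro m a f hf
      rw [hT true m a f]
      simp only [trans, hf, walkStep]
      rfl
    · have hstep := hT true s.mem (Machine.readInput x (s.reg i))
        (eqFlags fun r => r.elim (s.reg i) s.reg)
      rw [next_regCfg T q₀ m₀ x (ι true) s (s.reg i) (s.reg i) hstep]
      simp only [trans, eqFlags, Option.elim_none, Option.elim_some, decide_true, if_true,
        Machine.moveInput, actOp, opVal, Bool.toNat_false, Nat.add_zero, eval]
      rfl
  | seq p q ihp ihq =>
    obtain ⟨h₁, k₁, hk₁, hr₁⟩ := ihp hp.1 (fun c => ι (Sum.inl c)) (ι (Sum.inr q.entry))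
      (by
        intro c m a f
        rw [hT (Sum.inl c) m a f]
        simp only [trans, Option.elim_some]
        cases (p.trans c m a f).1 <;> rfl) s hs h k hk
    obtain ⟨h₂, k₂, hk₂, hr₂⟩ := ihq hp.2 (fun c => ι (Sum.inr c)) e
      (by
        intro c m a f
        rw [hT (Sum.inr c) m a f]
        simp only [trans]
        cases (q.trans c m a f).1 <;> rfl) (eval x p s) (eval_bounded x p hp.1 s hs) h₁ k₁ hk₁
    exact ⟨h₂, k₂, hk₂, hr₁.trans hr₂⟩
  | loop i p ih =>
    have hbody : Hosts T p (fun c => ι (Sum.inl c)) (ι (Sum.inr (some false))) := by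
      intro c m a f
      rw [hT (Sum.inl c) m a f]
      simp only [trans, Option.elim_some]
      cases (p.trans c m a f).1 <;> rfl
    have hrewind : ∀ m a f, T (ι (Sum.inr (some false))) m a f =
        some (rewindStep (ι (Sum.inr (some false))) (ι (Sum.inr (some true))) m a) := by
      intro m a f
      rw [hT (Sum.inr (some false)) m a f]
      cases a <;> rfl
    have hwalk : ∀ m a f, f none (some i) = false → T (ι (Sum.inr (some true))) m a f =
        some (walkStep (ι (Sum.inr (some true))) m) := by
      intro m a f hf
      rw [hT (Sum.inr (some true)) m a f]
      simp only [trans, hf, walkStep]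
      rfl
    -- `F t` is the state after `t` passes. The body keeps register `i`, so after pass `t` it still
    -- holds `t`, and the test at the end can fetch the symbol at position `t`.
    let F : ℕ → St β I σ := fun t =>
      (List.range t).foldl (fun s t => eval x p (s.setReg i t)) s
    have hF : ∀ t, F (t + 1) = eval x p ((F t).setReg i t) := by
      intro t
      simp only [F, List.range_succ, List.foldl_append, List.foldl_cons, List.foldl_nil]
    have hFb : ∀ t, t ≤ x.length + 2 → (F t).Bounded (x.length + 1) := by
      intro t ht
      induction t with
      | zero => exact hs
      | succ t iht =>
        rw [hF]
        exact eval_bounded x p hp.2 _ (bounded_setReg (iht (by omega)) i (by omega))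
    have hFi : ∀ t, (F (t + 1)).reg i = t := by
      intro t
      rw [hF, eval_keeps x i p hp.1]
      simp [St.setReg]
    -- one pass of the body, up to the test at its end
    have hpass : ∀ t, t ≤ x.length + 1 → ∀ h k, k ≤ x.length + 1 →
        RegRun T q₀ m₀ x (regCfg T q₀ m₀ (ι (Sum.inl p.entry)) ((F t).setReg i t) h k)
          (regCfg T q₀ m₀ (ι (Sum.inr (some true))) (F (t + 1)) t t) := by
      intro t ht h k hk
      obtain ⟨h₁, k₁, hk₁, hr₁⟩ := ih hp.2 _ _ hbody ((F t).setReg i t)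
        (bounded_setReg (hFb t (by omega)) i ht) h k hk
      rw [← hF] at hr₁
      have hr₂ := fetch_run T q₀ m₀ x _ _ i hrewind hwalk (F (t + 1)) (hFb _ (by omega)) h₁ k₁ hk₁
      rw [hFi] at hr₂
      exact hr₁.trans hr₂
    have htest : ∀ t, T (ι (Sum.inr (some true))) (F (t + 1)).mem (Machine.readInput x t)
        (eqFlags fun r => r.elim t (F (t + 1)).reg) =
        if x.length + 1 ≤ t then some (e, (F (t + 1)).mem, .stay, keepOp, none)
        else some (ι (Sum.inl p.entry), (F (t + 1)).mem, .stay, incOp (some i), none) := by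
      intro t
      rw [hT (Sum.inr (some true))]
      have h1 := readInput_eq_rightEnd x t
      simp only [trans, eqFlags, Option.elim_none, Option.elim_some, hFi, decide_true, if_true]
      by_cases ht : x.length + 1 ≤ t
      · rw [h1.2 ht, if_pos ht]
        rfl
      · rw [if_neg ht]
        cases ha : Machine.readInput x t with
        | rightEnd => exact absurd (h1.1 ha) ht
        | leftEnd => rfl
        | letter a => rfl
    have hiter : ∀ t, t ≤ x.length + 1 → ∃ h' k', k' ≤ x.length + 1 ∧
        RegRun T q₀ m₀ x (regCfg T q₀ m₀ (ι (Sum.inr none)) s h k)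
          (regCfg T q₀ m₀ (ι (Sum.inl p.entry)) ((F t).setReg i t) h' k') := by
      intro t ht
      induction t with
      | zero =>
        refine ⟨h, k, hk, RunIn.single (bounded_regCfg T q₀ m₀ hs hk) ?_⟩
        rw [next_regCfg T q₀ m₀ x _ s h k (hT (Sum.inr none) _ _ _)]
        simp only [trans, Machine.moveInput, Option.toList_none, List.append_nil]
        congr 2
        · simp only [F, St.setReg, List.range_zero, List.foldl_nil, St.mk.injEq, true_and, and_true]
          funext r
          by_cases hr : r = i
          · simp [hr, clearOp, opVal]
          · simp [hr, clearOp, opVal]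
      | succ t iht =>
        obtain ⟨h₁, k₁, hk₁, hr₁⟩ := iht (by omega)
        refine ⟨t, t, by omega, (hr₁.trans (hpass t (by omega) h₁ k₁ hk₁)).trans
          (RunIn.single (bounded_regCfg T q₀ m₀ (hFb _ (by omega)) (by omega)) ?_)⟩
        have h2 := htest t
        rw [if_neg (by omega)] at h2
        rw [next_regCfg T q₀ m₀ x _ (F (t + 1)) t t h2]
        simp only [Machine.moveInput, Option.toList_none, List.append_nil]
        congr 2
        · simp only [St.setReg, St.mk.injEq, true_and, and_true]
          funext r
          by_cases hr : r = i
          · subst hr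
            simp [incOp, opVal, hFi]
          · simp [hr, incOp, opVal]
    obtain ⟨h₁, k₁, hk₁, hr₁⟩ := hiter (x.length + 1) le_rfl
    -- The body is also run at the right end marker, position `|x| + 1`, before the test there
    -- leaves the loop; this makes `|x| + 2` passes.
    refine ⟨x.length + 1, x.length + 1, le_rfl,
      (hr₁.trans (hpass _ le_rfl h₁ k₁ hk₁)).trans
        (RunIn.single (bounded_regCfg T q₀ m₀ (hFb _ le_rfl) le_rfl) ?_)⟩
    have h2 := htest (x.length + 1)
    rw [if_pos le_rfl] at h2
    rw [next_regCfg T q₀ m₀ x _ (F (x.length + 2)) _ _ h2]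
    simp only [Machine.moveInput, Option.toList_none, List.append_nil, keepOp, opVal,
      Option.elim_some, Option.elim_none, Bool.toNat_false, Nat.add_zero]
    rfl

end compile

/-- Well-formed programs compute functions in FL. -/
theorem fl_eval [Finite σ] [Finite I] [DecidableEq I] (p : Prog α β I σ) (hp : p.WellFormed)
    (m₀ : σ) : FL fun x => (eval x p ⟨m₀, fun _ => 0, []⟩).out := by
  have := finite_point p
  -- The control point `none`, reached when the program ends, has no transition, so the register
  -- machine halts there.
  let T : Option p.Point → σ → InSym α → (Option I → Option I → Bool) →
      Option (Outcome (Option p.Point) β I σ) :=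
    fun q m a e => q.map fun c => p.trans c m a e
  refine RegMachine.fl_of_run (toReg (Option p.Point) T (some p.entry) m₀) _ ?_ ?_
  · obtain ⟨C, d, h⟩ := exists_cost_le p
    obtain ⟨e, he⟩ := poly_le_pow_add C d
    refine ⟨e, fun x => ?_⟩
    have h1 := length_out_le x p ⟨m₀, fun _ => 0, []⟩
    simp only [List.length_nil, Nat.zero_add] at h1
    exact h1.trans ((h _).trans (he _))
  · intro x
    have hs : (⟨m₀, fun _ => 0, []⟩ : St β I σ).Bounded (x.length + 1) :=
      fun _ => Nat.zero_le _
    obtain ⟨h', k', hk', hr⟩ := eval_run T (some p.entry) m₀ x p hp some none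
      (by
        intro c m a f
        simp only [T, Option.map_some]
        rcases p.trans c m a f with ⟨_ | c', t⟩ <;> rfl) ⟨m₀, fun _ => 0, []⟩ hs 0 0 (by omega)
    refine ⟨regCfg T (some p.entry) m₀ none (eval x p ⟨m₀, fun _ => 0, []⟩) h' k', ?_,
      bounded_regCfg T _ m₀ (eval_bounded x p hp _ hs) hk', ?_, rfl⟩
    · have hinit : (toReg (Option p.Point) T (some p.entry) m₀).init =
          regCfg T (some p.entry) m₀ (some p.entry) ⟨m₀, fun _ => 0, []⟩ 0 0 := by
        simp only [RegMachine.init, regCfg, toReg, RegMachine.Cfg.mk.injEq, true_and, and_true]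
        funext r
        cases r <;> rfl
      rw [hinit]
      exact hr
    · rfl

end Prog

end LogSpace

namespace TwoSat

open LogSpace

/-! ## The reduction on strings -/

/-- The binary digits at the beginning of a string. -/
def leadingBits : List Sym → List Bool
  | Sym.bit b :: ys => b :: leadingBits ys
  | _ => []

/-- The digit strings that follow the signs of a string. -/
def digitStrings : List Sym → List (List Bool)
  | [] => []
  | Sym.sign _ :: ys => leadingBits ys :: digitStrings ys
  | Sym.bit _ :: ys => digitStrings ys
  | Sym.endClause :: ys => digitStrings ys

/-- The number of occurrences in `ys` of the variable whose digits stand at the beginning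
of `ys`. -/
def laterCount (ys : List Sym) : ℕ := (digitStrings ys).count (leadingBits ys)

/-- The digits of the number `2 ^ j`. -/
def unary (j : ℕ) : List Sym := List.replicate j (Sym.bit false) ++ [Sym.bit true]

/-- The code of the clause that says that copy `i` of the variable with digits `w` implies
copy `j`. -/
def implCode (w : List Bool) (i j : ℕ) : List Sym :=
  (Sym.sign false :: (unary i ++ w.map Sym.bit)) ++
    (Sym.sign true :: (unary j ++ w.map Sym.bit)) ++ [Sym.endClause]

/-- The code of the clauses that say that the `k` copies of the variable with digits `w` are
equivalent. -/
def cycleCode (k : ℕ) (w : List Bool) : List Sym :=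
  (List.range k).flatMap fun t => implCode w t ((t + 1) % k)

/-- The given string, with every occurrence of a variable replaced by a copy of the variable; the
number of the copy is the number of later occurrences, but at most `k`. -/
def renamed (k : ℕ) : List Sym → List Sym
  | [] => []
  | Sym.sign s :: ys => (Sym.sign s :: unary (min k (laterCount ys))) ++ renamed k ys
  | Sym.bit b :: ys => Sym.bit b :: renamed k ys
  | Sym.endClause :: ys => Sym.endClause :: renamed k ys

/-- The cycles of implications for all variables, at the last occurrence of each. -/
def cycles (k : ℕ) : List Sym → List Sym
  | [] => []
  | Sym.sign _ :: ys =>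
    (if laterCount ys = 0 then cycleCode k (leadingBits ys) else []) ++ cycles k ys
  | Sym.bit _ :: ys => cycles k ys
  | Sym.endClause :: ys => cycles k ys

/-- Every variable occurs at most `k` times. -/
def FewOccurrences (k : ℕ) : List Sym → Prop
  | [] => True
  | Sym.sign _ :: ys => laterCount ys < k ∧ FewOccurrences k ys
  | Sym.bit _ :: ys => FewOccurrences k ys
  | Sym.endClause :: ys => FewOccurrences k ys

/-- A finite automaton that accepts the codes of formulas with one or two literals in every clause.
A state consists of the number of literals seen in the current clause and of the information whether
the last symbol is the digit zero. -/
def syntaxStep : Option (Fin 3 × Bool) → Sym → Option (Fin 3 × Bool)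
  | none, _ => none
  | some (n, _), Sym.bit b => if n = 0 then none else some (n, !b)
  | some (n, z), Sym.sign _ => if z ∨ n = 2 then none else some (n + 1, false)
  | some (n, z), Sym.endClause => if z ∨ n = 0 then none else some (0, false)

/-! ## The program for the reduction -/

/-- The phase of a comparison of digit strings. -/
inductive Mode
  | begin
  | run
  | same
  | different

/-- The memory that survives comparisons: the state of the syntax check, whether an error has been
found, whether the current symbol is a sign, and the number of later occurrences of the current
variable (at most `k`). -/
structure Main (k : ℕ) where
  syn : Option (Fin 3 × Bool)
  bad : Bool
  isSign : Bool
  later : Fin (k + 1)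

/-- The memory of the program: besides the main part, the phase of a comparison and a digit. -/
abbrev Memory (k : ℕ) : Type := Main k × Mode × Option Bool

instance : Finite Mode := by
  let f : Bool × Bool → Mode := fun b => match b with
    | (false, false) => .begin
    | (false, true) => .run
    | (true, false) => .same
    | (true, true) => .different
  refine Finite.of_surjective f ?_
  rintro (_ | _ | _ | _)
  exacts [⟨(false, false), rfl⟩, ⟨(false, true), rfl⟩, ⟨(true, false), rfl⟩, ⟨(true, true), rfl⟩]

instance (k : ℕ) : Finite (Main k) := by
  let f : Option (Fin 3 × Bool) × Bool × Bool × Fin (k + 1) → Main k :=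
    fun p => ⟨p.1, p.2.1, p.2.2.1, p.2.2.2⟩
  refine Finite.of_surjective f ?_
  rintro ⟨a, b, c, d⟩
  exact ⟨(a, b, c, d), rfl⟩

/-- Programs with four registers: `0` for the current position, `1` for a second position that is
compared with it, `2` and `3` for the digits that follow these positions. -/
abbrev Program (k : ℕ) : Type := Prog Sym Sym (Fin 4) (Memory k)

/-- States of programs. -/
abbrev State (k : ℕ) : Type := St Sym (Fin 4) (Memory k)

/-- The digit that is read. -/
def digitOf : InSym Sym → Option Bool
  | InSym.letter (Sym.bit b) => some b
  | _ => none

/-- Is a sign read? -/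
def isSignSym : InSym Sym → Bool
  | InSym.letter (Sym.sign _) => true
  | _ => false

/-- Is the right end marker read? -/
def isRightEnd {α : Type} : InSym α → Bool
  | InSym.rightEnd => true
  | _ => false

/-- An action that does not change the registers. -/
def memAct {k : ℕ} (i : Fin 4)
    (g : Memory k → InSym Sym → (Fin 4 → Fin 4 → Bool) → Memory k × Option Sym) : Program k :=
  .act i fun m a e => ((g m a e).1, fun r => (r, false), (g m a e).2)

/-- The operation on registers that copies register `1` to register `3`, if `copy` is true. -/
def copyOp (copy : Bool) (r : Fin 4) : Fin 4 × Bool :=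
  (if copy = true ∧ r = 3 then 1 else r, false)

/-- The operation on registers that increments register `3`, if `adv` is true. -/
def advanceOp (adv : Bool) (r : Fin 4) : Fin 4 × Bool := (r, adv && decide (r = 3))

/-- One step of a comparison of two digits. -/
def compareDigit : Option Bool → Option Bool → Mode
  | some b, some c => if b = c then .run else .different
  | none, none => .same
  | _, _ => .different

/-- The next phase of a comparison. -/
def nextMode : Mode → Option Bool → Option Bool → Mode
  | .begin, _, _ => .run
  | .run, b, c => compareDigit b c
  | md, _, _ => md

/-- Is the comparison in progress? -/
def Mode.active : Mode → Bool
  | .begin => true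
  | .run => true
  | _ => false

/-- One step of a comparison. -/
def compareBody (k : ℕ) : Program k :=
  .seq
    (.act 2 fun m a e =>
      ((m.1, if e 2 0 then .begin else m.2.1, digitOf a), copyOp (e 2 0), none))
    (.act 3 fun m a _ =>
      ((m.1, nextMode m.2.1 m.2.2 (digitOf a), m.2.2),
        advanceOp (m.2.1.active && !isRightEnd a), none))

/-- Compare the digits after the positions in registers `0` and `1`. -/
def compareProg (k : ℕ) : Program k := .loop 2 (compareBody k)

/-- The number of later occurrences, updated at a further position. -/
def countStep {k : ℕ} (j : Fin (k + 1)) (here sign : Bool) (md : Mode) : Fin (k + 1) :=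
  if here then 0
  else match sign, md with
    | true, .same => ⟨min k (j + 1), by omega⟩
    | _, _ => j

/-- Update the number of later occurrences at a further position. -/
def countBody (k : ℕ) : Program k :=
  .seq (compareProg k)
    (memAct 1 fun m a e =>
      (({ m.1 with later := countStep m.1.later (e 0 1) (isSignSym a) m.2.1 }, m.2), none))

/-- Count the later occurrences of the variable at the position in register `0`. -/
def countProg (k : ℕ) : Program k := .loop 1 (countBody k)

/-- Possibly write a symbol. -/
def say {k : ℕ} (g : Main k → Option Sym) : Program k := memAct 0 fun m _ _ => (m, g m.1)

/-- Write a symbol under a condition. -/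
def sayIf {k : ℕ} (gate : Main k → Bool) (a : Sym) : Program k :=
  say fun m => if gate m then some a else none

/-- A sequence of programs. -/
def seqMap {k : ℕ} {ι : Type} (p : ι → Program k) : List ι → Program k
  | [] => say fun _ => none
  | i :: l => .seq (p i) (seqMap p l)

/-- Write one of the digits after the position in register `0`, under a condition. -/
def copyBody {k : ℕ} (gate : Main k → Bool) : Program k :=
  memAct 2 fun m a e =>
    if e 2 0 then ((m.1, .run, m.2.2), none)
    else match m.2.1, digitOf a with
      | .run, some b => (m, if gate m.1 then some (Sym.bit b) else none)
      | _, _ => ((m.1, .same, m.2.2), none)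

/-- Write the digits after the position in register `0`, under a condition. -/
def copyDigits {k : ℕ} (gate : Main k → Bool) : Program k :=
  .seq (memAct 2 fun m _ _ => ((m.1, .same, m.2.2), none)) (.loop 2 (copyBody gate))

/-- Write the number of later occurrences in unary. -/
def unaryProg (k : ℕ) : Program k :=
  .seq (seqMap (fun t : ℕ => sayIf (fun m => m.isSign && decide (t < m.later.val))
      (Sym.bit false)) (List.range k))
    (sayIf (fun m => m.isSign) (Sym.bit true))

/-- Write a literal: a copy of the current variable. -/
def literalProg {k : ℕ} (gate : Main k → Bool) (s : Bool) (t : ℕ) : Program k :=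
  .seq (sayIf gate (Sym.sign s))
    (.seq (seqMap (fun _ : ℕ => sayIf gate (Sym.bit false)) (List.range t))
      (.seq (sayIf gate (Sym.bit true)) (copyDigits gate)))

/-- Is the current symbol the sign of the last occurrence of a variable? -/
def lastGate {k : ℕ} (m : Main k) : Bool := m.isSign && decide (m.later.val = 0)

/-- Write an implication between copies of the current variable. -/
def implProg {k : ℕ} (i j : ℕ) : Program k :=
  .seq (literalProg lastGate false i)
    (.seq (literalProg lastGate true j) (sayIf lastGate Sym.endClause))

/-- Write the cycle of implications for the current variable. -/
def cycleProg (k : ℕ) : Program k :=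
  seqMap (fun t : ℕ => implProg t ((t + 1) % k)) (List.range k)

/-- Read the current symbol, and write it. -/
def scanStep {k : ℕ} (m : Main k) : InSym Sym → Main k × Option Sym
  | .leftEnd => ({ m with isSign := false }, none)
  | .letter a => ({ m with syn := syntaxStep m.syn a, isSign := isSignSym (.letter a) }, some a)
  | .rightEnd =>
    ({ m with isSign := false, bad := m.bad || !decide (m.syn = some (0, false)) }, none)

/-- The first pass. -/
def renameBody (k : ℕ) : Program k :=
  .seq (memAct 0 fun m a _ => (((scanStep m.1 a).1, m.2), (scanStep m.1 a).2))
    (.seq (countProg k) (.seq (unaryProg k)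
      (memAct 0 fun m _ _ => (({ m.1 with
        bad := m.1.bad || (m.1.isSign && decide (m.1.later.val = k)) }, m.2), none))))

/-- The second pass. -/
def cycleBody (k : ℕ) : Program k :=
  .seq (memAct 0 fun m a _ => (({ m.1 with isSign := isSignSym a }, m.2), none))
    (.seq (countProg k) (cycleProg k))

/-- The program for the reduction. -/
def reductionProg (k : ℕ) : Program k :=
  .seq (.loop 0 (renameBody k)) (.seq (.loop 0 (cycleBody k))
    (sayIf (fun m => m.bad) (Sym.bit true)))

/-! ### Well-formedness -/

theorem keeps_memAct {k : ℕ} (i j : Fin 4)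
    (g : Memory k → InSym Sym → (Fin 4 → Fin 4 → Bool) → Memory k × Option Sym) :
    (memAct i g).Keeps j := fun _ _ _ => rfl

theorem wellFormed_memAct {k : ℕ} (i : Fin 4)
    (g : Memory k → InSym Sym → (Fin 4 → Fin 4 → Bool) → Memory k × Option Sym) :
    (memAct i g).WellFormed := fun _ _ _ _ h => by cases h

theorem keeps_compareProg {k : ℕ} (i : Fin 4) (h2 : i ≠ 2) (h3 : i ≠ 3) :
    (compareProg k).Keeps i :=
  ⟨h2, fun _ _ _ => by simp [copyOp, h3], fun _ _ _ => by simp [advanceOp, h3]⟩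

theorem wellFormed_compareProg (k : ℕ) : (compareProg k).WellFormed := by
  refine ⟨⟨fun _ _ _ => by simp [copyOp], fun _ _ _ => by simp [advanceOp]⟩, ?_, ?_⟩
  · intro m a e r h
    cases h
  · intro m a e r h
    simp only [advanceOp, Bool.and_eq_true, decide_eq_true_eq] at h
    refine ⟨h.2, ?_⟩
    rintro rfl
    simp [isRightEnd] at h

theorem keeps_countProg (k : ℕ) : (countProg k).Keeps 0 :=
  ⟨by decide, keeps_compareProg 0 (by decide) (by decide), keeps_memAct _ _ _⟩

theorem wellFormed_countProg (k : ℕ) : (countProg k).WellFormed :=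
  ⟨⟨keeps_compareProg 1 (by decide) (by decide), keeps_memAct _ _ _⟩, wellFormed_compareProg k,
    wellFormed_memAct _ _⟩

theorem keeps_seqMap {k : ℕ} {ι : Type} (p : ι → Program k) (j : Fin 4)
    (hp : ∀ i, (p i).Keeps j) (l : List ι) : (seqMap p l).Keeps j := by
  induction l with
  | nil => exact keeps_memAct _ _ _
  | cons i l ih => exact ⟨hp i, ih⟩

theorem wellFormed_seqMap {k : ℕ} {ι : Type} (p : ι → Program k)
    (hp : ∀ i, (p i).WellFormed) (l : List ι) : (seqMap p l).WellFormed := by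
  induction l with
  | nil => exact wellFormed_memAct _ _
  | cons i l ih => exact ⟨hp i, ih⟩

theorem keeps_literalProg {k : ℕ} (gate : Main k → Bool) (s : Bool) (t : ℕ) :
    (literalProg gate s t).Keeps 0 :=
  ⟨keeps_memAct _ _ _, keeps_seqMap _ _ (fun _ => keeps_memAct _ _ _) _, keeps_memAct _ _ _,
    keeps_memAct _ _ _, by decide, keeps_memAct _ _ _⟩

theorem wellFormed_literalProg {k : ℕ} (gate : Main k → Bool) (s : Bool) (t : ℕ) :
    (literalProg gate s t).WellFormed :=
  ⟨wellFormed_memAct _ _, wellFormed_seqMap _ (fun _ => wellFormed_memAct _ _) _,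
    wellFormed_memAct _ _, wellFormed_memAct _ _, keeps_memAct _ _ _, wellFormed_memAct _ _⟩

theorem keeps_implProg {k : ℕ} (i j : ℕ) : (implProg (k := k) i j).Keeps 0 :=
  ⟨keeps_literalProg _ _ _, keeps_literalProg _ _ _, keeps_memAct _ _ _⟩

theorem wellFormed_implProg {k : ℕ} (i j : ℕ) : (implProg (k := k) i j).WellFormed :=
  ⟨wellFormed_literalProg _ _ _, wellFormed_literalProg _ _ _, wellFormed_memAct _ _⟩

theorem keeps_renameBody (k : ℕ) : (renameBody k).Keeps 0 :=
  ⟨keeps_memAct _ _ _, keeps_countProg k,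
    ⟨keeps_seqMap _ _ (fun _ => keeps_memAct _ _ _) _, keeps_memAct _ _ _⟩, keeps_memAct _ _ _⟩

theorem keeps_cycleBody (k : ℕ) : (cycleBody k).Keeps 0 :=
  ⟨keeps_memAct _ _ _, keeps_countProg k, keeps_seqMap _ _ (fun _ => keeps_implProg _ _) _⟩

theorem wellFormed_reductionProg (k : ℕ) : (reductionProg k).WellFormed :=
  ⟨⟨keeps_renameBody k, wellFormed_memAct _ _, wellFormed_countProg k,
      ⟨wellFormed_seqMap _ (fun _ => wellFormed_memAct _ _) _, wellFormed_memAct _ _⟩,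
      wellFormed_memAct _ _⟩,
    ⟨keeps_cycleBody k, wellFormed_memAct _ _, wellFormed_countProg k, wellFormed_seqMap _
      (fun _ => wellFormed_implProg _ _) _⟩,
    wellFormed_memAct _ _⟩

/-! ### Correctness of the program -/

section correctness

variable {k : ℕ} (x : List Sym)

theorem eval_memAct (i : Fin 4)
    (g : Memory k → InSym Sym → (Fin 4 → Fin 4 → Bool) → Memory k × Option Sym) (s : State k) :
    Prog.eval x (memAct i g) s =
      ⟨(g s.mem (Machine.readInput x (s.reg i)) (eqFlags s.reg)).1, s.reg,
        s.out ++ (g s.mem (Machine.readInput x (s.reg i)) (eqFlags s.reg)).2.toList⟩ := by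
  simp [memAct, Prog.eval]

theorem readInput_succ {u : ℕ} (hu : u < x.length) :
    Machine.readInput x (u + 1) = InSym.letter x[u] := by
  simp [Machine.readInput, hu]

theorem readInput_of_length_lt {u : ℕ} (hu : x.length < u) :
    Machine.readInput x u = InSym.rightEnd := by
  rw [Prog.readInput_eq_rightEnd]
  exact hu

/-- The digits from position `u` on. -/
theorem leadingBits_drop (u : ℕ) :
    leadingBits (x.drop u) = match digitOf (Machine.readInput x (u + 1)) with
      | some b => b :: leadingBits (x.drop (u + 1))
      | none => [] := by
  rcases lt_or_ge u x.length with hu | hu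
  · rw [List.drop_eq_getElem_cons hu, readInput_succ x hu]
    cases x[u] <;> rfl
  · rw [List.drop_of_length_le hu, readInput_of_length_lt x (by omega)]
    rfl

theorem lt_length_of_digitOf {u : ℕ} {b : Bool}
    (h : digitOf (Machine.readInput x (u + 1)) = some b) : u < x.length := by
  by_contra hu
  rw [readInput_of_length_lt x (by omega)] at h
  cases h

/-- Comparisons change only the auxiliary part of the state. -/
def SameMain (s s' : State k) : Prop :=
  s'.mem.1 = s.mem.1 ∧ s'.reg 0 = s.reg 0 ∧ s'.reg 1 = s.reg 1 ∧ s'.out = s.out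

/-- The invariant of comparisons. -/
def CompareInv (P Q u : ℕ) (s : State k) : Prop :=
  match s.mem.2.1 with
  | .begin => False
  | .run => u ≤ x.length ∧ ∃ v, s.reg 3 = v + 1 ∧
      (leadingBits (x.drop u) = leadingBits (x.drop v) ↔
        leadingBits (x.drop P) = leadingBits (x.drop Q))
  | .same => leadingBits (x.drop P) = leadingBits (x.drop Q)
  | .different => leadingBits (x.drop P) ≠ leadingBits (x.drop Q)

/-- Register 2 runs over all positions. When it meets the position in register 0, register 3 is set
from register 1, and from then on the two move together, comparing digits. While the comparison is
running, the unread digit strings agree if and only if the original ones do. A register with value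
`P` points at letter `P - 1`, so the digits after it start `x.drop P`. -/
theorem eval_compareProg (s : State k) :
    SameMain s (Prog.eval x (compareProg k) s) ∧
    (s.reg 0 ≤ x.length → s.reg 1 ≤ x.length →
      ((Prog.eval x (compareProg k) s).mem.2.1 = .same ↔
        leadingBits (x.drop (s.reg 0)) = leadingBits (x.drop (s.reg 1)))) := by
  have key := Prog.loop_induction x (2 : Fin 4) (compareBody k)
    (fun t s' => SameMain s s' ∧
      (s.reg 0 ≤ x.length → s.reg 1 ≤ x.length → ∀ u, t = u + 1 → s.reg 0 ≤ u →
        CompareInv x (s.reg 0) (s.reg 1) u s')) s ⟨⟨rfl, rfl, rfl, rfl⟩, by omega⟩ ?_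
  · obtain ⟨h1, h2⟩ := key
    refine ⟨h1, fun hP hQ => ?_⟩
    have h := h2 hP hQ (x.length + 1) rfl (by omega)
    rw [CompareInv] at h
    unfold compareProg
    split at h
    · exact h.elim
    -- The comparison cannot still be running after the last pass: that would require `|x| + 1 ≤
    -- |x|`.
    · omega
    · simp_all
    · simp_all
  · rintro t s' ht ⟨⟨hm, h0, h1, ho⟩, hinv⟩
    refine ⟨?_, ?_⟩
    · simp [SameMain, compareBody, Prog.eval, St.setReg, copyOp, advanceOp, hm, h0, h1, ho]
    · rintro hP hQ u hut hu
      obtain rfl : t = u := by omega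
      by_cases hPt : t = s.reg 0
      · have hr : isRightEnd (Machine.readInput x (s.reg 1)) = false := by
          have := Prog.readInput_eq_rightEnd x (s.reg 1)
          cases hc : Machine.readInput x (s.reg 1) <;> simp_all [isRightEnd]
          omega
        simp only [CompareInv, compareBody, Prog.eval, St.setReg, copyOp, advanceOp, eqFlags, hPt,
          nextMode, Mode.active]
        simp [h0, h1, hr, hP]
      · obtain ⟨u', rfl⟩ : ∃ u', t = u' + 1 := ⟨t - 1, by omega⟩
        have hi := hinv hP hQ u' rfl (by omega)
        obtain ⟨⟨mm, md, d⟩, reg, out⟩ := s'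
        simp only [CompareInv] at hi
        have hne : ¬ u' + 1 = reg 0 := by
          simp only at h0
          omega
        cases md with
        | begin => exact hi.elim
        | same =>
          simpa [CompareInv, compareBody, Prog.eval, St.setReg, copyOp, advanceOp, eqFlags, hne,
            nextMode]
            using hi
        | different =>
          simpa [CompareInv, compareBody, Prog.eval, St.setReg, copyOp, advanceOp, eqFlags, hne,
            nextMode]
            using hi
        | run =>
          obtain ⟨hu', v, hv, hiff⟩ := hi
          rw [leadingBits_drop x u', leadingBits_drop x v] at hiff
          cases hb : digitOf (Machine.readInput x (u' + 1)) with
          | none =>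
            cases hc : digitOf (Machine.readInput x (v + 1)) with
            | none =>
              simp [hb, hc] at hiff
              simp [CompareInv, compareBody, Prog.eval, St.setReg, copyOp, advanceOp, eqFlags, hne,
            nextMode,
                hv, hb, hc, compareDigit, hiff]
            | some c =>
              simp [hb, hc] at hiff
              simp [CompareInv, compareBody, Prog.eval, St.setReg, copyOp, advanceOp, eqFlags, hne,
            nextMode,
                hv, hb, hc, compareDigit, hiff]
          | some b =>
            cases hc : digitOf (Machine.readInput x (v + 1)) with
            | none =>
              simp [hb, hc] at hiff
              simp [CompareInv, compareBody, Prog.eval, St.setReg, copyOp, advanceOp, eqFlags, hne,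
            nextMode,
                hv, hb, hc, compareDigit, hiff]
            | some c =>
              have hlt := lt_length_of_digitOf x hb
              have hr : isRightEnd (Machine.readInput x (v + 1)) = false := by
                rw [readInput_succ x (lt_length_of_digitOf x hc)]
                rfl
              by_cases hbc : b = c
              · simp [hb, hc, hbc] at hiff
                simp [CompareInv, compareBody, Prog.eval, St.setReg, copyOp, advanceOp, eqFlags, hne,
            nextMode,
                  hv, hb, hc, compareDigit, hiff, hbc, hr, Mode.active]
                omega
              · simp [hb, hc, hbc] at hiff
                simp [CompareInv, compareBody, Prog.eval, St.setReg, copyOp, advanceOp, eqFlags, hne,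
            nextMode,
                  hv, hb, hc, compareDigit, hiff, hbc]

theorem digitStrings_drop (u : ℕ) :
    digitStrings (x.drop u) = if isSignSym (Machine.readInput x (u + 1)) then
      leadingBits (x.drop (u + 1)) :: digitStrings (x.drop (u + 1))
      else digitStrings (x.drop (u + 1)) := by
  rcases lt_or_ge u x.length with hu | hu
  · rw [List.drop_eq_getElem_cons hu, readInput_succ x hu]
    cases x[u] <;> rfl
  · rw [List.drop_of_length_le hu, List.drop_of_length_le (by omega),
      readInput_of_length_lt x (by omega)]
    rfl

/-- The counter is reset when register 1 passes the position in register 0, so only later signs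
count. The invariant is that the matches found so far plus those in the unread suffix make up
`laterCount`; the stored counter is this number capped at `k`, which keeps the memory finite. -/
theorem eval_countProg (s : State k) :
    ∃ j, (Prog.eval x (countProg k) s).mem.1 = { s.mem.1 with later := j } ∧
      (Prog.eval x (countProg k) s).reg 0 = s.reg 0 ∧
      (Prog.eval x (countProg k) s).out = s.out ∧
      (s.reg 0 ≤ x.length → j.val = min k (laterCount (x.drop (s.reg 0)))) := by
  have key := Prog.loop_induction x (1 : Fin 4) (countBody k)
    (fun t s' => ∃ j, s'.mem.1 = { s.mem.1 with later := j } ∧ s'.reg 0 = s.reg 0 ∧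
      s'.out = s.out ∧ (s.reg 0 ≤ x.length → ∀ u, t = u + 1 → s.reg 0 ≤ u →
        ∃ m, j.val = min k m ∧
          m + (digitStrings (x.drop u)).count (leadingBits (x.drop (s.reg 0))) =
            laterCount (x.drop (s.reg 0)))) s
    ⟨s.mem.1.later, rfl, rfl, rfl, by omega⟩ ?_
  · obtain ⟨j, h1, h2, h3, h4⟩ := key
    refine ⟨j, h1, h2, h3, fun hP => ?_⟩
    obtain ⟨m, hm, hc⟩ := h4 hP (x.length + 1) rfl (by omega)
    rw [List.drop_of_length_le (show x.length ≤ x.length + 1 by omega)] at hc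
    simp only [digitStrings, List.count_nil, Nat.add_zero] at hc
    rw [hm, hc]
  · rintro t s' ht ⟨j, hj, h0, ho, hinv⟩
    obtain ⟨⟨c1, c2, c3, c4⟩, c5⟩ := eval_compareProg x (s'.setReg 1 t)
    have hs0 : (s'.setReg 1 t).reg 0 = s.reg 0 := h0
    have hs1 : (s'.setReg 1 t).reg 1 = t := rfl
    rw [hs0] at c2 c5
    rw [hs1] at c3 c5
    change _ = s'.mem.1 at c1
    change _ = s'.out at c4
    rw [hj] at c1
    rw [ho] at c4
    simp only [countBody, Prog.eval, eval_memAct]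
    set s'' := Prog.eval x (compareProg k) (s'.setReg 1 t) with hs''
    refine ⟨countStep j (eqFlags s''.reg 0 1) (isSignSym (Machine.readInput x (s''.reg 1)))
      s''.mem.2.1, by simp [c1], c2, by simp [c4], ?_⟩
    rintro hP u hut hu
    obtain rfl : t = u := by omega
    rw [eqFlags, c2, c3]
    by_cases hPt : s.reg 0 = t
    · refine ⟨0, by simp [countStep, hPt], ?_⟩
      simp [laterCount, hPt]
    · obtain ⟨u', rfl⟩ : ∃ u', t = u' + 1 := ⟨t - 1, by omega⟩
      obtain ⟨m, hm, hc⟩ := hinv hP u' rfl (by omega)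
      rw [digitStrings_drop] at hc
      cases hsign : isSignSym (Machine.readInput x (u' + 1)) with
      | false =>
        refine ⟨m, by simp [countStep, hPt, hm], ?_⟩
        simpa [hsign] using hc
      | true =>
        have hlt : u' + 1 ≤ x.length := by
          by_contra hlt
          rw [readInput_of_length_lt x (by omega)] at hsign
          cases hsign
        have c6 := c5 hP hlt
        rw [hsign, if_pos rfl] at hc
        by_cases hw : leadingBits (x.drop (s.reg 0)) = leadingBits (x.drop (u' + 1))
        · refine ⟨m + 1, ?_, ?_⟩
          · simp only [countStep, hPt, decide_false, Bool.false_eq_true, if_false, c6.2 hw, hm]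
            omega
          · rw [← hw, List.count_cons_self] at hc
            omega
        · refine ⟨m, ?_, ?_⟩
          · have c7 := mt c6.1 hw
            simp only [countStep, hPt, decide_false, Bool.false_eq_true, if_false]
            split <;> simp_all
          · rwa [List.count_cons_of_ne (Ne.symm hw)] at hc

/-- The program writes `w`, which depends on the memory and the current position, and changes only
auxiliary data. -/
def Writes (p : Program k) (w : Main k → ℕ → List Sym) : Prop :=
  ∀ s : State k, (Prog.eval x p s).mem.1 = s.mem.1 ∧ (Prog.eval x p s).reg 0 = s.reg 0 ∧
    (Prog.eval x p s).out = s.out ++ w s.mem.1 (s.reg 0)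

variable {x}

theorem Writes.seq {p q : Program k} {v w : Main k → ℕ → List Sym} (hp : Writes x p v)
    (hq : Writes x q w) : Writes x (.seq p q) fun m P => v m P ++ w m P := by
  intro s
  obtain ⟨h1, h2, h3⟩ := hp s
  obtain ⟨h4, h5, h6⟩ := hq (Prog.eval x p s)
  rw [Prog.eval, h4, h5, h6, h1, h2, h3, List.append_assoc]
  exact ⟨rfl, rfl, rfl⟩

theorem Writes.congr {p : Program k} {v w : Main k → ℕ → List Sym} (hp : Writes x p v)
    (h : ∀ m P, v m P = w m P) : Writes x p w := by
  obtain rfl : v = w := by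
    funext m P
    exact h m P
  exact hp

variable (x)

theorem writes_say (g : Main k → Option Sym) : Writes x (say g) fun m _ => (g m).toList := by
  intro s
  rw [say, eval_memAct]
  exact ⟨rfl, rfl, rfl⟩

theorem writes_seqMap {ι : Type} (p : ι → Program k) (w : ι → Main k → ℕ → List Sym)
    (hp : ∀ i, Writes x (p i) (w i)) (l : List ι) :
    Writes x (seqMap p l) fun m P => l.flatMap fun i => w i m P := by
  induction l with
  | nil => exact writes_say x _
  | cons i l ih => exact (hp i).seq ih

/-- The program writes `w`, which depends on the current position, if a condition holds. -/
def WritesIf (gate : Main k → Bool) (p : Program k) (w : ℕ → List Sym) : Prop :=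
  Writes x p fun m P => if gate m then w P else []

variable {x}

theorem WritesIf.seq {gate : Main k → Bool} {p q : Program k} {v w : ℕ → List Sym}
    (hp : WritesIf x gate p v) (hq : WritesIf x gate q w) :
    WritesIf x gate (.seq p q) fun P => v P ++ w P :=
  (Writes.seq hp hq).congr fun m P => by
    cases gate m <;> simp

variable (x)

theorem writesIf_sayIf (gate : Main k → Bool) (a : Sym) :
    WritesIf x gate (sayIf gate a) fun _ => [a] :=
  (writes_say x _).congr fun m P => by
    cases h : gate m <;> simp

theorem writesIf_seqMap {gate : Main k → Bool} {ι : Type} (p : ι → Program k)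
    (w : ι → ℕ → List Sym) (hp : ∀ i, WritesIf x gate (p i) (w i)) (l : List ι) :
    WritesIf x gate (seqMap p l) fun P => l.flatMap fun i => w i P :=
  (writes_seqMap x p _ hp l).congr fun m P => by
    cases gate m <;> simp

/-- Nothing is written before the loop reaches the position in register 0. Afterwards either copying
is in progress and the output followed by the remaining digits is the target, or copying has stopped
and the target is complete. -/
theorem writesIf_copyDigits (gate : Main k → Bool) :
    WritesIf x gate (copyDigits gate) fun P => (leadingBits (x.drop P)).map Sym.bit := by
  intro s
  rw [copyDigits, Prog.eval, eval_memAct]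
  set s₀ : State k := ⟨(s.mem.1, .same, s.mem.2.2), s.reg, s.out ++ none.toList⟩ with hs₀
  set w : List Sym :=
    if gate s.mem.1 then (leadingBits (x.drop (s.reg 0))).map Sym.bit else [] with hw
  have key := Prog.loop_induction x (2 : Fin 4) (copyBody gate)
    (fun t s' => s'.mem.1 = s.mem.1 ∧ s'.reg 0 = s.reg 0 ∧
      (t ≤ s.reg 0 → s'.mem.2.1 = .same ∧ s'.out = s.out) ∧
      (∀ u, t = u + 1 → s.reg 0 ≤ u →
        (s'.mem.2.1 = .run ∧ s'.out ++ (if gate s.mem.1 then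
          (leadingBits (x.drop u)).map Sym.bit else []) = s.out ++ w) ∨
        (s'.mem.2.1 = .same ∧ s'.out = s.out ++ w))) s₀
    ⟨rfl, rfl, fun _ => ⟨rfl, by simp [hs₀]⟩, by omega⟩ ?_
  · obtain ⟨h1, h2, h3, h4⟩ := key
    refine ⟨h1, h2, ?_⟩
    by_cases hP : s.reg 0 ≤ x.length + 1
    · rcases h4 (x.length + 1) rfl hP with ⟨-, h⟩ | ⟨-, h⟩
      · rw [← h, List.drop_of_length_le (show x.length ≤ x.length + 1 by omega)]
        simp [leadingBits]
      · exact h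
    · rw [(h3 (by omega)).2]
      simp only
      rw [List.drop_of_length_le (by omega)]
      simp [leadingBits]
  · rintro t ⟨⟨mm, md, d⟩, reg, out⟩ ht ⟨h1, h2, h3, h4⟩
    simp only at h1 h2 h3 h4
    subst h1
    have hE : eqFlags (Function.update reg 2 t) 2 0 = decide (t = s.reg 0) := by
      simp [eqFlags, h2]
    have h2' : Function.update reg 2 t 0 = s.reg 0 := by simp [h2]
    simp only [copyBody, eval_memAct, St.setReg, hE, h2', Function.update_self]
    by_cases hPt : t = s.reg 0
    · obtain ⟨-, rfl⟩ := h3 (by omega)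
      simp only [hPt, decide_true, if_true, true_and, Option.toList_none, List.append_nil]
      refine ⟨fun h => by omega, fun u hu _ => Or.inl ?_⟩
      obtain rfl : s.reg 0 = u := by omega
      rw [hw]
    · simp only [hPt, decide_false, Bool.false_eq_true, if_false]
      refine ⟨?_, ?_, ?_, ?_⟩
      · cases md <;> cases digitOf (Machine.readInput x t) <;> rfl
      · trivial
      · intro h
        obtain ⟨rfl, rfl⟩ := h3 (by omega)
        simp
      · intro u hut hu
        obtain ⟨u', rfl⟩ : ∃ u', t = u' + 1 := ⟨t - 1, by omega⟩
        obtain rfl : u' + 1 = u := by omega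
        rcases h4 u' rfl (by omega) with ⟨rfl, h⟩ | ⟨rfl, h⟩
        · rw [leadingBits_drop] at h
          cases hb : digitOf (Machine.readInput x (u' + 1)) with
          | none =>
            right
            simpa [hb] using h
          | some b =>
            left
            rw [← h]
            cases hg : gate s.mem.1 <;> simp [hb]
        · right
          simpa using h

theorem flatMap_ite_lt (a : Sym) (k j : ℕ) :
    ((List.range k).flatMap fun t => if t < j then [a] else []) = List.replicate (min k j) a := by
  induction k with
  | zero => simp
  | succ k ih =>
    rw [List.range_succ, List.flatMap_append, ih, List.flatMap_singleton]
    by_cases h : k < j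
    · rw [if_pos h, show min (k + 1) j = min k j + 1 by omega, List.replicate_succ']
    · rw [if_neg h, show min (k + 1) j = min k j by omega, List.append_nil]

/-- A stored number of at most `k` is written by `k` fixed conditional outputs, the `t`-th being
active when `t` is below the number. -/
theorem writes_unaryProg : Writes x (unaryProg k) fun m _ =>
    if m.isSign then unary m.later.val else [] := by
  refine ((writes_seqMap x _ _ (fun t => writes_say x _) _).seq (writes_say x _)).congr fun m P => ?_
  cases h : m.isSign with
  | false => simp [h]
  | true =>
    have h1 := flatMap_ite_lt (Sym.bit false) k m.later.val
    rw [min_eq_right (by omega)] at h1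
    simp only [unary, ← h1, h, Bool.true_and, decide_eq_true_eq, if_true, Option.toList_some]
    congr 2
    funext t
    by_cases ht : t < m.later.val <;> simp [ht]

theorem writesIf_literalProg (gate : Main k → Bool) (b : Bool) (t : ℕ) :
    WritesIf x gate (literalProg gate b t) fun P =>
      Sym.sign b :: (unary t ++ (leadingBits (x.drop P)).map Sym.bit) := by
  have h := (writesIf_sayIf x gate (Sym.sign b)).seq
    ((writesIf_seqMap x (fun _ : ℕ => sayIf gate (Sym.bit false)) _
      (fun _ => writesIf_sayIf x gate _) (List.range t)).seq
      ((writesIf_sayIf x gate (Sym.bit true)).seq (writesIf_copyDigits x gate)))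
  refine h.congr fun m P => ?_
  have h1 : ((List.range t).flatMap fun _ => [Sym.bit false]) =
      List.replicate t (Sym.bit false) := by
    simp [← List.map_eq_flatMap]
  simp [unary, h1]

theorem writesIf_cycleProg : WritesIf x lastGate (cycleProg k) fun P =>
    cycleCode k (leadingBits (x.drop P)) := by
  have h (i j : ℕ) : WritesIf x lastGate (implProg (k := k) i j) fun P =>
      implCode (leadingBits (x.drop P)) i j :=
    Writes.congr ((writesIf_literalProg x lastGate false i).seq
      ((writesIf_literalProg x lastGate true j).seq
        (writesIf_sayIf x lastGate Sym.endClause))) fun m P => by simp [implCode]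
  exact writesIf_seqMap x _ _ (fun t => h t ((t + 1) % k)) _

/-- Acceptance by the syntax automaton. -/
def Accepts (q : Option (Fin 3 × Bool)) (ys : List Sym) : Prop :=
  ys.foldl syntaxStep q = some (0, false)

/-- The effect of one round of the first pass. -/
theorem eval_renameBody (s : State k) (hs : s.reg 0 ≤ x.length + 1) :
    (Prog.eval x (renameBody k) s).mem.1.syn = (scanStep s.mem.1 (Machine.readInput x (s.reg 0))).1.syn ∧
    (Prog.eval x (renameBody k) s).mem.1.bad =
      ((scanStep s.mem.1 (Machine.readInput x (s.reg 0))).1.bad ||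
        (isSignSym (Machine.readInput x (s.reg 0)) &&
          decide (k ≤ laterCount (x.drop (s.reg 0))))) ∧
    (Prog.eval x (renameBody k) s).out = s.out ++
      (scanStep s.mem.1 (Machine.readInput x (s.reg 0))).2.toList ++
      if isSignSym (Machine.readInput x (s.reg 0)) then
        unary (min k (laterCount (x.drop (s.reg 0)))) else [] := by
  have hsign : (scanStep s.mem.1 (Machine.readInput x (s.reg 0))).1.isSign =
      isSignSym (Machine.readInput x (s.reg 0)) := by
    cases Machine.readInput x (s.reg 0) <;> rfl
  rw [renameBody, Prog.eval, eval_memAct]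
  set m₁ := (scanStep s.mem.1 (Machine.readInput x (s.reg 0))).1
  set o₁ := (scanStep s.mem.1 (Machine.readInput x (s.reg 0))).2
  obtain ⟨j, h1, h2, h3, h4⟩ := eval_countProg x (⟨(m₁, s.mem.2), s.reg, s.out ++ o₁.toList⟩ : State k)
  rw [Prog.eval, Prog.eval]
  set s₂ := Prog.eval x (countProg k) (⟨(m₁, s.mem.2), s.reg, s.out ++ o₁.toList⟩ : State k)
  obtain ⟨h5, h6, h7⟩ := writes_unaryProg x s₂
  rw [eval_memAct]
  simp only at h1 h2 h3 h4 h5 h6 h7 ⊢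
  rw [h5, h7, h3, h1]
  simp only [hsign]
  cases hc : isSignSym (Machine.readInput x (s.reg 0)) with
  | false => simp
  | true =>
    have hle : s.reg 0 ≤ x.length := by
      by_contra hlt
      rw [readInput_of_length_lt x (by omega)] at hc
      cases hc
    have hj := h4 hle
    refine ⟨trivial, ?_, ?_⟩
    · simp [hj]
    · simp [hj]

theorem eval_cycleBody (s : State k) (hk : 0 < k) :
    (Prog.eval x (cycleBody k) s).mem.1.bad = s.mem.1.bad ∧
    (Prog.eval x (cycleBody k) s).out = s.out ++
      if isSignSym (Machine.readInput x (s.reg 0)) = true ∧ laterCount (x.drop (s.reg 0)) = 0 then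
        cycleCode k (leadingBits (x.drop (s.reg 0))) else [] := by
  rw [cycleBody, Prog.eval, eval_memAct]
  set m₁ : Main k := { s.mem.1 with isSign := isSignSym (Machine.readInput x (s.reg 0)) } with hm₁
  obtain ⟨j, h1, h2, h3, h4⟩ := eval_countProg x
    (⟨(m₁, s.mem.2), s.reg, s.out ++ (none : Option Sym).toList⟩ : State k)
  rw [Prog.eval]
  set s₂ := Prog.eval x (countProg k)
    (⟨(m₁, s.mem.2), s.reg, s.out ++ (none : Option Sym).toList⟩ : State k)
  obtain ⟨h5, h6, h7⟩ := writesIf_cycleProg x s₂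
  simp only [Option.toList_none, List.append_nil] at h1 h2 h3 h4 h5 h6 h7 ⊢
  rw [h5, h7, h3, h1, h2]
  simp only [lastGate, hm₁]
  cases hc : isSignSym (Machine.readInput x (s.reg 0)) with
  | false => simp
  | true =>
    have hle : s.reg 0 ≤ x.length := by
      by_contra hlt
      rw [readInput_of_length_lt x (by omega)] at hc
      cases hc
    have hj := h4 hle
    -- Here `0 < k` matters: a counter capped at 0 would make every occurrence look like the last
    -- one.
    have hiff : min k (laterCount (x.drop (s.reg 0))) = 0 ↔ laterCount (x.drop (s.reg 0)) = 0 := by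
      omega
    simp [hj, hiff]

/-- The effect of the first pass. -/
theorem eval_renameLoop (s : State k) (hsyn : s.mem.1.syn = some (0, false))
    (hbad : s.mem.1.bad = false) (hout : s.out = []) :
    ((Prog.eval x (.loop 0 (renameBody k)) s).mem.1.bad = false ↔
      FewOccurrences k x ∧ Accepts (some (0, false)) x) ∧
    (Prog.eval x (.loop 0 (renameBody k)) s).out = renamed k x := by
  -- After pass `t = u`, exactly `u` letters have been read, and the state combined with the same
  -- quantity for `x.drop u` gives the value for `x`. The final pass, at the right end marker, adds
  -- the verdict of the syntax automaton to the error flag.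
  have key := Prog.loop_induction x (0 : Fin 4) (renameBody k)
    (fun t s' => (t = 0 → s' = s) ∧
      (∀ u, t = u + 1 → u ≤ x.length →
        (x.drop u).foldl syntaxStep s'.mem.1.syn = x.foldl syntaxStep (some (0, false)) ∧
        ((s'.mem.1.bad = false ∧ FewOccurrences k (x.drop u)) ↔ FewOccurrences k x) ∧
        s'.out ++ renamed k (x.drop u) = renamed k x) ∧
      (t = x.length + 2 → (s'.mem.1.bad = false ↔
        FewOccurrences k x ∧ Accepts (some (0, false)) x) ∧ s'.out = renamed k x)) s
    ⟨fun _ => rfl, by omega, by omega⟩ ?_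
  · exact key.2.2 rfl
  · rintro t s' ht ⟨h1, h2, -⟩
    have hreg : (s'.setReg 0 t).reg 0 = t := by simp [St.setReg]
    obtain ⟨e1, e2, e3⟩ := eval_renameBody x (s'.setReg 0 t) (by omega)
    rw [hreg] at e1 e2 e3
    change _ = (scanStep s'.mem.1 (Machine.readInput x t)).1.syn at e1
    change _ = ((scanStep s'.mem.1 (Machine.readInput x t)).1.bad || _) at e2
    change _ = s'.out ++ (scanStep s'.mem.1 (Machine.readInput x t)).2.toList ++ _ at e3
    rw [e1, e2, e3]
    refine ⟨by omega, ?_, ?_⟩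
    · rintro u hut hu
      obtain rfl : t = u := by omega
      rcases t with _ | u
      · obtain rfl := h1 rfl
        simp [Machine.readInput, scanStep, isSignSym, hsyn, hbad, hout]
      · obtain ⟨i1, i2, i3⟩ := h2 u rfl (by omega)
        rw [List.drop_eq_getElem_cons (by omega : u < x.length)] at i1 i2 i3
        rw [readInput_succ x (by omega : u < x.length)]
        refine ⟨i1, ?_, ?_⟩
        · rw [← i2]
          cases x[u] <;> simp [scanStep, isSignSym, FewOccurrences, and_assoc]
        · rw [← i3]
          cases x[u] <;> simp [scanStep, isSignSym, renamed]
    · intro htl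
      obtain rfl : t = x.length + 1 := by omega
      obtain ⟨i1, i2, i3⟩ := h2 x.length rfl le_rfl
      rw [List.drop_length] at i1 i2 i3
      rw [readInput_of_length_lt x (by omega)]
      simp only [List.foldl_nil] at i1
      constructor
      · rw [← i2, Accepts, ← i1]
        simp [scanStep, isSignSym, FewOccurrences]
      · simpa [scanStep, isSignSym, renamed] using i3

theorem eval_cycleLoop (s : State k) (hk : 0 < k) :
    (Prog.eval x (.loop 0 (cycleBody k)) s).mem.1.bad = s.mem.1.bad ∧
    (Prog.eval x (.loop 0 (cycleBody k)) s).out = s.out ++ cycles k x := by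
  -- The truncated `t - 1` is intended: the pass at the left end marker consumes no letter, so the
  -- suffix is all of `x` for both `t = 0` and `t = 1`.
  have key := Prog.loop_induction x (0 : Fin 4) (cycleBody k)
    (fun t s' => s'.mem.1.bad = s.mem.1.bad ∧
      s'.out ++ cycles k (x.drop (t - 1)) = s.out ++ cycles k x) s
    ⟨rfl, by simp⟩ ?_
  · obtain ⟨h1, h2⟩ := key
    refine ⟨h1, ?_⟩
    rw [← h2, List.drop_of_length_le (by omega)]
    simp [cycles]
  · rintro t s' ht ⟨h1, h2⟩
    have hreg : (s'.setReg 0 t).reg 0 = t := by simp [St.setReg]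
    obtain ⟨e1, e2⟩ := eval_cycleBody x (s'.setReg 0 t) hk
    rw [hreg] at e2
    change _ = s'.mem.1.bad at e1
    change _ = s'.out ++ _ at e2
    rw [e1, e2]
    refine ⟨h1, ?_⟩
    rw [← h2]
    rcases t with _ | u
    · simp [Machine.readInput, isSignSym]
    · simp only [Nat.add_sub_cancel]
      rcases lt_or_ge u x.length with hu | hu
      · rw [List.drop_eq_getElem_cons hu, readInput_succ x hu]
        cases x[u] <;> simp [isSignSym, cycles]
      · rw [List.drop_of_length_le hu, List.drop_of_length_le (by omega),
          readInput_of_length_lt x (by omega)]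
        simp [isSignSym, cycles]

end correctness

open Classical in
/-- The reduction. -/
noncomputable def reduction (k : ℕ) (x : List Sym) : List Sym :=
  renamed k x ++ cycles k x ++
    if FewOccurrences k x ∧ Accepts (some (0, false)) x then [] else [Sym.bit true]

theorem fl_reduction (k : ℕ) (hk : 0 < k) : FL (reduction k) := by
  have h := Prog.fl_eval (reductionProg k) (wellFormed_reductionProg k)
    (⟨some (0, false), false, false, 0⟩, Mode.same, none)
  convert h using 1
  funext x
  obtain ⟨h1, h2⟩ := eval_renameLoop (k := k) x
    ⟨(⟨some (0, false), false, false, 0⟩, Mode.same, none), fun _ => 0, []⟩ rfl rfl rfl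
  rw [reductionProg, Prog.eval, Prog.eval]
  set s₁ := Prog.eval x (.loop 0 (renameBody k))
    ⟨(⟨some (0, false), false, false, 0⟩, Mode.same, none), fun _ => 0, []⟩
  obtain ⟨h3, h4⟩ := eval_cycleLoop x s₁ hk
  set s₂ := Prog.eval x (.loop 0 (cycleBody k)) s₁
  obtain ⟨-, -, h5⟩ := writesIf_sayIf x (fun m : Main k => m.bad) (Sym.bit true) s₂
  simp only [h3] at h5
  rw [h5, h4, h2, reduction]
  congr 1
  cases hb : s₁.mem.1.bad with
  | false => simp [h1.1 hb]
  | true =>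
    rw [if_neg]
    · simp
    · intro hc
      rw [h1.2 hc] at hb
      cases hb

/-! ## Codes of formulas -/

/-- Every clause has one or two literals. -/
def OneOrTwo (φ : CNF) : Prop := ∀ c ∈ φ, c ≠ [] ∧ c.length ≤ 2

theorem encode_cons (c : Clause) (φ : CNF) :
    encode (c :: φ) = c.flatMap encodeLiteral ++ Sym.endClause :: encode φ := by
  simp [encode, encodeClause]

theorem encode_append (φ ψ : CNF) : encode (φ ++ ψ) = encode φ ++ encode ψ := by
  simp [encode]

/-- A nonempty code ends with the end-of-clause symbol. Appending a digit is thus a safe way to map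
rejected inputs to strings that encode nothing. -/
theorem not_encode_append_bit (φ : CNF) (ys : List Sym) (b : Bool) :
    encode φ ≠ ys ++ [Sym.bit b] := by
  intro h
  rcases List.eq_nil_or_concat φ with rfl | ⟨φ', c, rfl⟩
  · simp [encode] at h
  · rw [List.concat_eq_append, encode_append, encode_cons] at h
    have := congrArg List.getLast? h
    simp [encode] at this

theorem bits_bit (b : Bool) (n : ℕ) (h : n = 0 → b = true) :
    (Nat.bit b n).bits = b :: n.bits := Nat.bits_append_bit n b h

theorem bits_injective : Function.Injective Nat.bits := fun m n h => by
  rw [← foldr_bit_bits m, h, foldr_bit_bits]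

theorem foldl_syntaxStep_none (ys : List Sym) : ys.foldl syntaxStep none = none := by
  induction ys with
  | nil => rfl
  | cons a ys ih => cases a <;> exact ih

/-- Digits are written least significant first, so those of a nonzero number end in 1, and 0 has no
digits. Forbidding a final digit 0 therefore singles out the canonical numerals. -/
theorem foldl_syntaxStep_bits (n : Fin 3) (hn : n ≠ 0) (v : ℕ) (z : Bool) :
    (v.bits.map Sym.bit).foldl syntaxStep (some (n, z)) =
      some (n, if v = 0 then z else false) := by
  induction v using Nat.binaryRec' generalizing z with
  | zero => simp
  | bit b m h ih =>
    have h0 : Nat.bit b m ≠ 0 := by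
      rw [Nat.bit_ne_zero_iff]
      exact h
    rw [bits_bit b m h, List.map_cons, List.foldl_cons]
    simp only [syntaxStep, hn, if_false, ih, h0]
    by_cases hm : m = 0
    · simp [hm, h hm]
    · simp [hm]

theorem foldl_syntaxStep_literal (n : Fin 3) (hn : n ≠ 2) (l : Literal) :
    (encodeLiteral l).foldl syntaxStep (some (n, false)) = some (n + 1, false) := by
  have hn' : n + 1 ≠ 0 := by
    fin_cases n <;> simp_all
  rw [encodeLiteral, List.foldl_cons]
  simp only [syntaxStep, hn, Bool.false_eq_true, or_self, if_false]
  rw [foldl_syntaxStep_bits _ hn']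
  simp

theorem accepts_encode (φ : CNF) (h : OneOrTwo φ) : Accepts (some (0, false)) (encode φ) := by
  induction φ with
  | nil => rfl
  | cons c φ ih =>
    have ih' := ih fun d hd => h d (List.mem_cons_of_mem _ hd)
    obtain ⟨h1, h2⟩ := h c List.mem_cons_self
    rw [encode_cons, Accepts, List.foldl_append, List.foldl_cons]
    rcases c with _ | ⟨l, _ | ⟨l', _ | ⟨l'', c⟩⟩⟩
    · exact absurd rfl h1
    · simpa [foldl_syntaxStep_literal, syntaxStep, Accepts] using ih'
    · simpa [foldl_syntaxStep_literal, syntaxStep, Accepts] using ih'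
    · simp at h2

/-- The second claim is needed to make the induction work: it describes suffixes that begin inside a
numeral. If the last digit read was 0, more digits must follow, whence `v ≠ 0`. -/
theorem exists_of_accepts (ys : List Sym) :
    (Accepts (some (0, false)) ys → ∃ φ, OneOrTwo φ ∧ encode φ = ys) ∧
    (∀ (n : Fin 3) (z : Bool), n ≠ 0 → Accepts (some (n, z)) ys →
      ∃ (v : ℕ) (c : Clause) (φ : CNF), (z = true → v ≠ 0) ∧ n.val + c.length ≤ 2 ∧ OneOrTwo φ ∧
        ys = v.bits.map Sym.bit ++ encode (c :: φ)) := by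
  have hdead (zs : List Sym) : ¬ Accepts none zs := by
    rw [Accepts, foldl_syntaxStep_none]
    simp
  induction ys with
  | nil =>
    refine ⟨fun _ => ⟨[], by simp [OneOrTwo], rfl⟩, fun n z hn h => ?_⟩
    simp only [Accepts, List.foldl_nil, Option.some.injEq, Prod.mk.injEq] at h
    exact absurd h.1 hn
  | cons a ys ih =>
    obtain ⟨ih1, ih2⟩ := ih
    constructor
    · intro h
      cases a with
      | bit b => exact (hdead ys h).elim
      | endClause => exact (hdead ys h).elim
      | sign s =>
        obtain ⟨v, c, φ, -, h1, h2, rfl⟩ := ih2 1 false (by decide) h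
        refine ⟨(⟨v, s⟩ :: c) :: φ, ?_, by simp [encode_cons, encodeLiteral]⟩
        intro d hd
        rcases List.mem_cons.1 hd with rfl | hd
        · refine ⟨by simp, ?_⟩
          simp only [List.length_cons]
          simp at h1
          omega
        · exact h2 d hd
    · intro n z hn h
      cases a with
      | bit b =>
        have h' : Accepts (some (n, !b)) ys := by
          simpa [Accepts, syntaxStep, hn] using h
        obtain ⟨v, c, φ, h1, h2, h3, rfl⟩ := ih2 n (!b) hn h'
        have hb : v = 0 → b = true := by
          intro hv
          cases b
          · exact absurd hv (h1 rfl)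
          · rfl
        refine ⟨Nat.bit b v, c, φ, fun _ => ?_, h2, h3, by simp [bits_bit b v hb]⟩
        rw [Nat.bit_ne_zero_iff]
        exact hb
      | sign s =>
        by_cases hz : z = true ∨ n = 2
        · rw [Accepts, List.foldl_cons] at h
          simp only [syntaxStep, hz, if_true] at h
          exact (hdead ys h).elim
        · rw [Accepts, List.foldl_cons] at h
          simp only [syntaxStep, hz, if_false] at h
          rw [not_or] at hz
          obtain ⟨v, c, φ, -, h2, h3, rfl⟩ := ih2 (n + 1) false (by fin_cases n <;> simp_all) h
          refine ⟨0, ⟨v, s⟩ :: c, φ, fun h => absurd h hz.1, ?_, h3,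
            by simp [encode_cons, encodeLiteral]⟩
          fin_cases n <;> simp_all
      | endClause =>
        by_cases hz : z = true ∨ n = 0
        · rw [Accepts, List.foldl_cons] at h
          simp only [syntaxStep, hz, if_true] at h
          exact (hdead ys h).elim
        · rw [Accepts, List.foldl_cons] at h
          simp only [syntaxStep, hz, if_false] at h
          rw [not_or] at hz
          obtain ⟨φ, h1, rfl⟩ := ih1 h
          refine ⟨0, [], φ, fun h => absurd h hz.1, ?_, h1, by simp [encode_cons]⟩
          have := n.isLt
          simp
          omega

/-! ## The variables of a code -/

/-- The variables of a list of literals. -/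
def varsOf (ls : List Literal) : List ℕ := ls.map Literal.var

theorem leadingBits_bits_append (bs : List Bool) (ys : List Sym) (h : leadingBits ys = []) :
    leadingBits (bs.map Sym.bit ++ ys) = bs := by
  induction bs with
  | nil => exact h
  | cons b bs ih => simp [leadingBits, ih]

theorem leadingBits_code (c : Clause) (ys : List Sym) :
    leadingBits (c.flatMap encodeLiteral ++ Sym.endClause :: ys) = [] := by
  cases c <;> simp [leadingBits, encodeLiteral]

theorem digitStrings_bits_append (bs : List Bool) (ys : List Sym) :
    digitStrings (bs.map Sym.bit ++ ys) = digitStrings ys := by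
  induction bs with
  | nil => rfl
  | cons b bs ih => simpa [digitStrings] using ih

theorem digitStrings_code (c : Clause) (ys : List Sym) :
    digitStrings (c.flatMap encodeLiteral ++ Sym.endClause :: ys) =
      (varsOf c).map Nat.bits ++ digitStrings ys := by
  induction c with
  | nil => rfl
  | cons l c ih =>
    simp only [List.flatMap_cons, encodeLiteral, List.cons_append, List.append_assoc,
      digitStrings, digitStrings_bits_append, ih, varsOf, List.map_cons]
    rw [leadingBits_bits_append _ _ (leadingBits_code c ys)]

theorem digitStrings_encode (φ : CNF) :
    digitStrings (encode φ) = (varsOf φ.flatten).map Nat.bits := by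
  induction φ with
  | nil => rfl
  | cons c φ ih =>
    rw [encode_cons, digitStrings_code, ih]
    simp [varsOf]

/-- This links strings and formulas: as `Nat.bits` is injective, counting equal digit strings is
counting equal variables. -/
theorem laterCount_code (v : ℕ) (c : Clause) (φ : CNF) :
    laterCount (v.bits.map Sym.bit ++
      (c.flatMap encodeLiteral ++ Sym.endClause :: encode φ)) =
      (varsOf (c ++ φ.flatten)).count v := by
  rw [laterCount, leadingBits_bits_append _ _ (leadingBits_code c _), digitStrings_bits_append,
    digitStrings_code, digitStrings_encode, ← List.map_append,
    List.count_map_of_injective _ _ bits_injective]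
  simp [varsOf]

/-- The local test at every sign suffices, since the first occurrence of a digit string sees all the
others as later ones. -/
theorem fewOccurrences_iff (k : ℕ) (ys : List Sym) :
    FewOccurrences k ys ↔ ∀ w, (digitStrings ys).count w ≤ k := by
  induction ys with
  | nil => simp [FewOccurrences, digitStrings]
  | cons a ys ih =>
    cases a with
    | bit b => exact ih
    | endClause => exact ih
    | sign s =>
      rw [FewOccurrences, ih, digitStrings, laterCount]
      constructor
      · rintro ⟨h1, h2⟩ w
        rw [List.count_cons]
        have := h2 w
        split
        · rename_i h
          rw [beq_iff_eq] at h
          rw [h] at h1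
          omega
        · exact this
      · intro h
        refine ⟨?_, fun w => ?_⟩
        · have := h (leadingBits ys)
          rw [List.count_cons_self] at this
          omega
        · have := h w
          rw [List.count_cons] at this
          omega

theorem fewOccurrences_encode (k : ℕ) (φ : CNF) :
    FewOccurrences k (encode φ) ↔ ∀ v, occurrences φ v ≤ k := by
  rw [fewOccurrences_iff, digitStrings_encode]
  constructor
  · intro h v
    have := h v.bits
    rwa [List.count_map_of_injective _ _ bits_injective] at this
  · intro h w
    by_cases hw : ∃ v : ℕ, v.bits = w
    · obtain ⟨v, rfl⟩ := hw
      rw [List.count_map_of_injective _ _ bits_injective]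
      exact h v
    · rw [List.count_eq_zero_of_not_mem]
      · exact Nat.zero_le _
      · intro hmem
        obtain ⟨v, -, hv⟩ := List.mem_map.1 hmem
        exact hw ⟨v, hv⟩

/-! ## The reduction on formulas -/

/-- Copy `j` of the variable `v`. -/
def copyVar (j v : ℕ) : ℕ := 2 ^ j * (2 * v + 1)

theorem copyVar_zero (v : ℕ) : copyVar 0 v = Nat.bit true v := by
  simp [copyVar, Nat.bit]

theorem copyVar_succ (j v : ℕ) : copyVar (j + 1) v = Nat.bit false (copyVar j v) := by
  simp only [copyVar, Nat.bit, pow_succ, cond_false]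
  ring

theorem copyVar_pos (j v : ℕ) : copyVar j v ≠ 0 := by
  simp [copyVar]

/-- This explains the choice of `copyVar`: least significant digit first, a copy is a
self-delimiting unary prefix followed by the unchanged digits of `v`, so renaming only inserts
symbols after a sign. -/
theorem bits_copyVar (j v : ℕ) :
    (copyVar j v).bits = List.replicate j false ++ true :: v.bits := by
  induction j with
  | zero => simp [copyVar_zero]
  | succ j ih =>
    rw [copyVar_succ, bits_bit _ _ fun h => absurd h (copyVar_pos j v), ih, List.replicate_succ,
      List.cons_append]

theorem map_bits_copyVar (j v : ℕ) :
    (copyVar j v).bits.map Sym.bit = unary j ++ v.bits.map Sym.bit := by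
  simp [bits_copyVar, unary]

theorem copyVar_inj {i j v w : ℕ} (h : copyVar i v = copyVar j w) : i = j ∧ v = w := by
  induction i generalizing j with
  | zero =>
    cases j with
    | zero =>
      simp only [copyVar] at h
      omega
    | succ j =>
      simp only [copyVar_succ, copyVar_zero, Nat.bit, cond_false, cond_true] at h
      omega
  | succ i ih =>
    cases j with
    | zero =>
      simp only [copyVar_succ, copyVar_zero, Nat.bit, cond_false, cond_true] at h
      omega
    | succ j =>
      simp only [copyVar_succ, Nat.bit, cond_false] at h
      obtain ⟨rfl, rfl⟩ := ih (j := j) (by omega)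
      exact ⟨rfl, rfl⟩

/-- The literals of a clause, with copies of the variables; `rest` are the literals that follow. -/
def renameClause (k : ℕ) (rest : List Literal) : Clause → Clause
  | [] => []
  | l :: c => ⟨copyVar (min k ((varsOf (c ++ rest)).count l.var)) l.var, l.pos⟩ ::
      renameClause k rest c

/-- Replace every occurrence of a variable by a copy. -/
def renameCNF (k : ℕ) : CNF → CNF
  | [] => []
  | c :: φ => renameClause k φ.flatten c :: renameCNF k φ

/-- The clause that says that copy `t` of `v` implies the next copy. -/
def implClause (k : ℕ) (p : ℕ × ℕ) : Clause :=
  [⟨copyVar p.2 p.1, false⟩, ⟨copyVar ((p.2 + 1) % k) p.1, true⟩]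

/-- The clauses that say that all copies of a variable are equivalent. -/
def cyclesCNF (k : ℕ) (vs : List ℕ) : CNF :=
  (vs.dedup ×ˢ List.range k).map (implClause k)

/-- The reduction on formulas. -/
def reduceCNF (k : ℕ) (φ : CNF) : CNF := renameCNF k φ ++ cyclesCNF k (varsOf φ.flatten)

theorem renamed_bits_append (k : ℕ) (bs : List Bool) (ys : List Sym) :
    renamed k (bs.map Sym.bit ++ ys) = bs.map Sym.bit ++ renamed k ys := by
  induction bs with
  | nil => rfl
  | cons b bs ih => simpa [renamed] using ih

theorem renamed_code (k : ℕ) (c : Clause) (φ : CNF) :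
    renamed k (c.flatMap encodeLiteral ++ Sym.endClause :: encode φ) =
      (renameClause k φ.flatten c).flatMap encodeLiteral ++
        Sym.endClause :: renamed k (encode φ) := by
  induction c with
  | nil => rfl
  | cons l c ih =>
    simp only [List.flatMap_cons, encodeLiteral, List.cons_append, List.append_assoc, renamed,
      renamed_bits_append, ih, renameClause, map_bits_copyVar, laterCount_code]

theorem renamed_encode (k : ℕ) (φ : CNF) : renamed k (encode φ) = encode (renameCNF k φ) := by
  induction φ with
  | nil => rfl
  | cons c φ ih => rw [encode_cons, renamed_code, ih, renameCNF, encode_cons]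

/-- `List.dedup` keeps the last occurrence of each element, which matches the string reduction,
where a cycle is emitted at a sign with no later occurrence of its variable. -/
theorem cyclesCNF_cons (k v : ℕ) (vs : List ℕ) :
    encode (cyclesCNF k (v :: vs)) =
      (if vs.count v = 0 then cycleCode k v.bits else []) ++ encode (cyclesCNF k vs) := by
  by_cases h : v ∈ vs
  · have h0 : vs.count v ≠ 0 := (List.count_pos_iff.2 h).ne'
    rw [if_neg h0, cyclesCNF, List.dedup_cons_of_mem h, List.nil_append, cyclesCNF]
  · rw [if_pos (List.count_eq_zero_of_not_mem h), cyclesCNF, List.dedup_cons_of_notMem h,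
      List.product_cons, List.map_append, encode_append, cyclesCNF]
    congr 1
    simp [encode, cycleCode, List.flatMap_map, encodeClause, implClause, implCode,
      encodeLiteral, map_bits_copyVar]

theorem cycles_bits_append (k : ℕ) (bs : List Bool) (ys : List Sym) :
    cycles k (bs.map Sym.bit ++ ys) = cycles k ys := by
  induction bs with
  | nil => rfl
  | cons b bs ih => simpa [cycles] using ih

theorem cycles_encode (k : ℕ) (φ : CNF) :
    cycles k (encode φ) = encode (cyclesCNF k (varsOf φ.flatten)) := by
  induction φ with
  | nil => simp [varsOf, encode, cyclesCNF, cycles]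
  | cons c φ ih =>
    rw [encode_cons]
    induction c with
    | nil => simpa [cycles] using ih
    | cons l c ihc =>
      have hvars : varsOf ((l :: c) :: φ).flatten = l.var :: varsOf (c :: φ).flatten := by
        simp [varsOf]
      rw [hvars, cyclesCNF_cons, ← ihc]
      simp only [List.flatMap_cons, encodeLiteral, List.cons_append, List.append_assoc, cycles,
        cycles_bits_append, laterCount_code]
      rw [leadingBits_bits_append _ _ (leadingBits_code c _)]
      simp [varsOf]

theorem reduction_encode (k : ℕ) (φ : CNF) (h : OneOrTwo φ) (hk : ∀ v, occurrences φ v ≤ k) :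
    reduction k (encode φ) = encode (reduceCNF k φ) := by
  rw [reduction, if_pos ⟨(fewOccurrences_encode k φ).2 hk, accepts_encode φ h⟩, List.append_nil,
    renamed_encode, cycles_encode, reduceCNF, encode_append]

/-! ## Correctness of the reduction on formulas -/

theorem length_renameClause (k : ℕ) (rest : List Literal) (c : Clause) :
    (renameClause k rest c).length = c.length := by
  induction c with
  | nil => rfl
  | cons l c ih => simp [renameClause, ih]

theorem length_renameCNF (k : ℕ) (φ : CNF) : (renameCNF k φ).length = φ.length := by
  induction φ with
  | nil => rfl
  | cons c φ ih => simp [renameCNF, ih]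

theorem isTwoCNF_reduceCNF (k : ℕ) (φ : CNF) (h : OneOrTwo φ) : IsTwoCNF (reduceCNF k φ) := by
  intro c hc
  rcases List.mem_append.1 hc with hc | hc
  · clear * - h hc
    induction φ with
    | nil => cases hc
    | cons d φ ih =>
      rcases List.mem_cons.1 hc with rfl | hc
      · rw [length_renameClause]
        exact (h d List.mem_cons_self).2
      · exact ih (fun e he => h e (List.mem_cons_of_mem _ he)) hc
  · obtain ⟨p, -, rfl⟩ := List.mem_map.1 hc
    exact le_rfl

/-- The variables of the renamed formula. -/
def renameVars (k : ℕ) : List ℕ → List ℕ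
  | [] => []
  | v :: vs => copyVar (min k (vs.count v)) v :: renameVars k vs

theorem varsOf_renameCNF (k : ℕ) (φ : CNF) :
    varsOf (renameCNF k φ).flatten = renameVars k (varsOf φ.flatten) := by
  induction φ with
  | nil => rfl
  | cons c φ ih =>
    have h : varsOf (renameClause k φ.flatten c) ++ renameVars k (varsOf φ.flatten) =
        renameVars k (varsOf (c ++ φ.flatten)) := by
      clear ih
      induction c with
      | nil => rfl
      | cons l c ih => simpa [renameClause, varsOf, renameVars] using ih
    rw [List.flatten_cons, ← h, ← ih]
    simp [renameCNF, varsOf]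

theorem exists_of_mem_renameVars {k u : ℕ} {vs : List ℕ} (h : u ∈ renameVars k vs) :
    ∃ j v, v ∈ vs ∧ j < vs.count v ∧ u = copyVar j v := by
  induction vs with
  | nil => cases h
  | cons w vs ih =>
    rcases List.mem_cons.1 h with rfl | h
    · refine ⟨_, w, List.mem_cons_self, ?_, rfl⟩
      rw [List.count_cons_self]
      omega
    · obtain ⟨j, v, h1, h2, h3⟩ := ih h
      exact ⟨j, v, List.mem_cons_of_mem _ h1, h2.trans_le List.count_le_count_cons, h3⟩

/-- Different occurrences of a variable have different numbers of later occurrences. Under the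
hypothesis these are below `k`, so the cap in `renameVars` never takes effect. -/
theorem nodup_renameVars {k : ℕ} {vs : List ℕ} (h : ∀ v, vs.count v ≤ k) :
    (renameVars k vs).Nodup := by
  induction vs with
  | nil => exact List.nodup_nil
  | cons w vs ih =>
    refine List.nodup_cons.2 ⟨fun hmem => ?_, ih fun v => List.count_le_count_cons.trans (h v)⟩
    obtain ⟨j, v, -, h2, h3⟩ := exists_of_mem_renameVars hmem
    obtain ⟨h4, rfl⟩ := copyVar_inj h3
    have := h w
    rw [List.count_cons_self] at this
    omega

/-- Each copy is the premise of at most one implication and the conclusion of at most one, because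
`t ↦ (t + 1) % k` is injective below `k` and `copyVar` is injective. -/
theorem count_varsOf_cyclesCNF (k : ℕ) (vs : List ℕ) (u : ℕ) :
    (varsOf (cyclesCNF k vs).flatten).count u ≤ 2 := by
  have hsplit (L : List (ℕ × ℕ)) : (varsOf (L.map (implClause k)).flatten).count u =
      (L.map fun p => copyVar p.2 p.1).count u +
        (L.map fun p => copyVar ((p.2 + 1) % k) p.1).count u := by
    induction L with
    | nil => rfl
    | cons p L ih =>
      simp only [varsOf, List.map_cons, List.flatten_cons, List.map_append, List.count_append,
        implClause, List.count_cons, List.map_nil, List.count_nil] at ih ⊢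
      omega
  have hL : (vs.dedup ×ˢ List.range k).Nodup :=
    (List.nodup_dedup vs).product List.nodup_range
  have h1 : ((vs.dedup ×ˢ List.range k).map fun p => copyVar p.2 p.1).Nodup := by
    refine hL.map_on ?_
    rintro ⟨v, i⟩ - ⟨w, j⟩ - h
    obtain ⟨rfl, rfl⟩ := copyVar_inj h
    rfl
  have h2 : ((vs.dedup ×ˢ List.range k).map fun p => copyVar ((p.2 + 1) % k) p.1).Nodup := by
    refine hL.map_on ?_
    rintro ⟨v, i⟩ hi ⟨w, j⟩ hj h
    obtain ⟨hij, rfl⟩ := copyVar_inj h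
    simp only [List.mem_product, List.mem_range] at hi hj hij
    have hmod (t : ℕ) (ht : t < k) : (t + 1) % k = if t + 1 = k then 0 else t + 1 := by
      split
      · rename_i h
        rw [h, Nat.mod_self]
      · exact Nat.mod_eq_of_lt (by omega)
    rw [hmod i hi.2, hmod j hj.2] at hij
    obtain rfl : i = j := by
      split at hij <;> split at hij <;> omega
    rfl
  rw [cyclesCNF, hsplit]
  have := List.nodup_iff_count_le_one.1 h1 u
  have := List.nodup_iff_count_le_one.1 h2 u
  omega

theorem occurrences_reduceCNF (k : ℕ) (φ : CNF) (h : ∀ v, occurrences φ v ≤ k) (u : ℕ) :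
    occurrences (reduceCNF k φ) u ≤ 3 := by
  have h1 := List.nodup_iff_count_le_one.1 (nodup_renameVars (k := k) (vs := varsOf φ.flatten) h) u
  have h2 := count_varsOf_cyclesCNF k (varsOf φ.flatten) u
  rw [← varsOf_renameCNF] at h1
  rw [occurrences, reduceCNF, List.flatten_append, List.map_append, List.count_append]
  change (varsOf _).count u + (varsOf _).count u ≤ 3
  omega

/-! ### Equisatisfiability -/

theorem mem_renameClause {k : ℕ} {rest : List Literal} {c : Clause} {l : Literal}
    (hl : l ∈ c) : ∃ j, ⟨copyVar j l.var, l.pos⟩ ∈ renameClause k rest c := by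
  induction c with
  | nil => cases hl
  | cons l' c ih =>
    rcases List.mem_cons.1 hl with rfl | hl
    · exact ⟨_, List.mem_cons_self⟩
    · obtain ⟨j, hj⟩ := ih hl
      exact ⟨j, List.mem_cons_of_mem _ hj⟩

theorem exists_of_mem_renameClause {k : ℕ} {rest : List Literal} {c : Clause} {l : Literal}
    (hl : l ∈ renameClause k rest c) :
    ∃ l' ∈ c, ∃ j, j < (varsOf (c ++ rest)).count l'.var ∧ l = ⟨copyVar j l'.var, l'.pos⟩ := by
  induction c with
  | nil => cases hl
  | cons l' c ih =>
    rcases List.mem_cons.1 hl with rfl | hl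
    · refine ⟨l', List.mem_cons_self, _, ?_, rfl⟩
      simp only [varsOf, List.cons_append, List.map_cons, List.count_cons_self]
      omega
    · obtain ⟨l'', h1, j, h2, h3⟩ := ih hl
      exact ⟨l'', List.mem_cons_of_mem _ h1, j, h2.trans_le List.count_le_count_cons, h3⟩

theorem mem_renameCNF {k : ℕ} {φ : CNF} {c : Clause} (hc : c ∈ φ) :
    ∃ rest, renameClause k rest c ∈ renameCNF k φ ∧
      ∀ v, (varsOf (c ++ rest)).count v ≤ occurrences φ v := by
  induction φ with
  | nil => cases hc
  | cons d φ ih =>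
    rcases List.mem_cons.1 hc with rfl | hc
    · exact ⟨φ.flatten, List.mem_cons_self, fun v => le_rfl⟩
    · obtain ⟨rest, h1, h2⟩ := ih hc
      refine ⟨rest, List.mem_cons_of_mem _ h1, fun v => (h2 v).trans ?_⟩
      simp [occurrences]

theorem exists_of_mem_renameCNF {k : ℕ} {φ : CNF} {c : Clause} (hc : c ∈ renameCNF k φ) :
    ∃ d ∈ φ, ∃ rest, c = renameClause k rest d := by
  induction φ with
  | nil => cases hc
  | cons d φ ih =>
    rcases List.mem_cons.1 hc with rfl | hc
    · exact ⟨d, List.mem_cons_self, _, rfl⟩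
    · obtain ⟨d', h1, h2⟩ := ih hc
      exact ⟨d', List.mem_cons_of_mem _ h1, h2⟩

theorem Satisfiable.reduceCNF {k : ℕ} {φ : CNF} (h : Satisfiable φ) :
    Satisfiable (reduceCNF k φ) := by
  classical
  obtain ⟨σ, hσ⟩ := h
  -- Every copy receives the value of its original; injectivity of `copyVar` makes this consistent.
  let τ : ℕ → Bool := fun u => decide (∃ j v, copyVar j v = u ∧ σ v = true)
  have hτ (j v : ℕ) : τ (copyVar j v) = σ v := by
    cases hv : σ v with
    | true => exact decide_eq_true ⟨j, v, rfl, hv⟩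
    | false =>
      refine decide_eq_false ?_
      rintro ⟨i, w, h1, h2⟩
      rw [(copyVar_inj h1).2, hv] at h2
      cases h2
  refine ⟨τ, fun c hc => ?_⟩
  rcases List.mem_append.1 hc with hc | hc
  · obtain ⟨d, hd, rest, rfl⟩ := exists_of_mem_renameCNF hc
    obtain ⟨l, hl, hlσ⟩ := hσ d hd
    obtain ⟨j, hj⟩ := mem_renameClause (k := k) (rest := rest) hl
    exact ⟨_, hj, (hτ _ _).trans hlσ⟩
  · obtain ⟨⟨v, t⟩, -, rfl⟩ := List.mem_map.1 hc
    cases hv : σ v with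
    | false => exact ⟨⟨copyVar t v, false⟩, by simp [implClause], (hτ _ _).trans hv⟩
    | true => exact ⟨⟨copyVar ((t + 1) % k) v, true⟩, by simp [implClause], (hτ _ _).trans hv⟩

theorem satisfiable_of_reduceCNF {k : ℕ} {φ : CNF} (hk : ∀ v, occurrences φ v ≤ k)
    (h : Satisfiable (reduceCNF k φ)) : Satisfiable φ := by
  obtain ⟨τ, hτ⟩ := h
  have himp (v t : ℕ) (hv : v ∈ varsOf φ.flatten) (ht : t < k)
      (h : τ (copyVar t v) = true) : τ (copyVar ((t + 1) % k) v) = true := by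
    have hmem : implClause k (v, t) ∈ TwoSat.reduceCNF k φ := by
      refine List.mem_append_right _ (List.mem_map_of_mem ?_)
      simp [hv, ht]
    obtain ⟨l, hl, hτl⟩ := hτ _ hmem
    simp only [implClause, List.mem_cons, List.not_mem_nil, or_false] at hl
    rcases hl with rfl | rfl
    · simp [h] at hτl
    · exact hτl
  have hup (v s t : ℕ) (hv : v ∈ varsOf φ.flatten) (ht : s + t < k)
      (h : τ (copyVar s v) = true) : τ (copyVar (s + t) v) = true := by
    induction t with
    | zero => exact h
    | succ t ih =>
      have := himp v (s + t) hv (by omega) (ih (by omega))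
      rwa [Nat.mod_eq_of_lt (by omega)] at this
  have hall (v t : ℕ) (hv : v ∈ varsOf φ.flatten) (ht : t < k) :
      τ (copyVar t v) = τ (copyVar 0 v) := by
    rw [Bool.eq_iff_iff]
    constructor
    -- Truth travels from copy `t` up to copy `k - 1`, and the closing implication of the cycle
    -- brings it back to copy 0.
    · intro h
      have h1 := hup v t (k - 1 - t) hv (by omega) h
      have h2 := himp v _ hv (by omega) h1
      rwa [show t + (k - 1 - t) + 1 = k by omega, Nat.mod_self] at h2
    · intro h
      have h1 := hup v 0 t hv (by omega) h
      rwa [Nat.zero_add] at h1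
  refine ⟨fun v => τ (copyVar 0 v), fun c hc => ?_⟩
  obtain ⟨rest, h1, h2⟩ := mem_renameCNF (k := k) hc
  obtain ⟨l, hl, hτl⟩ := hτ _ (List.mem_append_left _ h1)
  obtain ⟨l', hl', j, hj, rfl⟩ := exists_of_mem_renameClause hl
  refine ⟨l', hl', ?_⟩
  have hv : l'.var ∈ varsOf φ.flatten :=
    List.mem_map_of_mem (List.mem_flatten_of_mem hc hl')
  rw [← hτl]
  exact (hall _ j hv (hj.trans_le ((h2 _).trans (hk _)))).symm

/-! ## Size parameters -/

theorem numVars_le (φ : CNF) (h : OneOrTwo φ) : numVars φ ≤ 2 * numClauses φ := by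
  refine (List.toFinset_card_le _).trans ?_
  rw [List.length_map, List.length_flatten, numClauses]
  refine (List.sum_le_card_nsmul (φ.map List.length) 2 ?_).trans ?_
  · intro n hn
    obtain ⟨c, hc, rfl⟩ := List.mem_map.1 hn
    exact (h c hc).2
  · simp [Nat.mul_comm]

/-- Since no clause is empty, there are at most as many clauses as literal occurrences, and each
variable accounts for at most `k` of these. -/
theorem numClauses_le (k : ℕ) (φ : CNF) (h : OneOrTwo φ) (hk : ∀ v, occurrences φ v ≤ k) :
    numClauses φ ≤ k * numVars φ := by
  have h1 : numClauses φ ≤ (φ.flatten.map Literal.var).length := by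
    rw [List.length_map, List.length_flatten, numClauses]
    have := List.card_nsmul_le_sum (φ.map List.length) 1 (by
      intro n hn
      obtain ⟨c, hc, rfl⟩ := List.mem_map.1 hn
      exact List.length_pos_iff.2 (h c hc).1)
    simpa using this
  refine h1.trans ?_
  rw [← List.sum_toFinset_count_eq_length, Nat.mul_comm, numVars, ← smul_eq_mul]
  exact Finset.sum_le_card_nsmul _ _ _ fun v _ => hk v

theorem numClauses_reduceCNF (k : ℕ) (φ : CNF) :
    numClauses (reduceCNF k φ) = numClauses φ + numVars φ * k := by
  rw [numClauses, reduceCNF, List.length_append, length_renameCNF, cyclesCNF, List.length_map,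
    List.length_product, List.length_range, numClauses, numVars, List.card_toFinset, varsOf]

theorem numVars_reduceCNF (k : ℕ) (φ : CNF) (hk : ∀ v, occurrences φ v ≤ k) :
    numVars (reduceCNF k φ) ≤ numVars φ * k := by
  have hsub : ((reduceCNF k φ).flatten.map Literal.var).toFinset ⊆
      ((varsOf φ.flatten).toFinset ×ˢ Finset.range k).image fun p => copyVar p.2 p.1 := by
    intro u hu
    rw [List.mem_toFinset, reduceCNF, List.flatten_append, List.map_append,
      List.mem_append] at hu
    rw [Finset.mem_image]
    rcases hu with hu | hu
    · change u ∈ varsOf _ at hu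
      rw [varsOf_renameCNF] at hu
      obtain ⟨j, v, hv, hj, rfl⟩ := exists_of_mem_renameVars hu
      exact ⟨(v, j), by simpa using ⟨hv, hj.trans_le (hk v)⟩, rfl⟩
    · obtain ⟨l, hl, rfl⟩ := List.mem_map.1 hu
      obtain ⟨c, hc, hlc⟩ := List.mem_flatten.1 hl
      obtain ⟨⟨v, t⟩, hp, rfl⟩ := List.mem_map.1 hc
      simp only [List.mem_product, List.mem_dedup, List.mem_range] at hp
      simp only [implClause, List.mem_cons, List.not_mem_nil, or_false] at hlc
      rcases hlc with rfl | rfl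
      · exact ⟨(v, t), by simpa using hp, rfl⟩
      · exact ⟨(v, (t + 1) % k), by simpa using ⟨hp.1, Nat.mod_lt _ (by omega)⟩, rfl⟩
  refine (Finset.card_le_card hsub).trans (Finset.card_image_le.trans ?_)
  rw [Finset.card_product, Finset.card_range]
  rfl

/-- The constant comes from the worst case, clauses to clauses: `c + n * k` with `n ≤ 2 * c` is at
most `(2 * k + 1) * c`. -/
theorem size_reduceCNF_le (k : ℕ) (φ : CNF) (h : OneOrTwo φ) (hk : ∀ v, occurrences φ v ≤ k)
    {g g' : CNF → ℕ} (hg : g = numVars ∨ g = numClauses) (hg' : g' = numVars ∨ g' = numClauses) :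
    g' (reduceCNF k φ) ≤ (2 * k + 1) * g φ := by
  have h1 := numVars_le φ h
  have h2 := numClauses_le k φ h hk
  have h3 := numVars_reduceCNF k φ hk
  have h4 := numClauses_reduceCNF k φ
  rcases hg with rfl | rfl <;> rcases hg' with rfl | rfl <;> nlinarith

/-! ## The reductions between the problems -/

/-- The bound 3 on occurrences makes the image acceptable for every `k' ≥ 3`. For the direction from
3 to a larger bound the identity would not do: inputs with too many occurrences must be rejected,
which the reduction does. -/
theorem shortReducible (k k' : ℕ) (hk : 0 < k) (hk' : 3 ≤ k') {g g' : CNF → ℕ}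
    (hg : g = numVars ∨ g = numClauses) (hg' : g' = numVars ∨ g' = numClauses) :
    ShortReducible ⟨twoSAT k, onStrings g⟩ ⟨twoSAT k', onStrings g'⟩ := by
  refine ⟨reduction k, fl_reduction k hk, 2 * k + 1, by omega, fun x => ?_⟩
  by_cases hx : ∃ φ, OneOrTwo φ ∧ (∀ v, occurrences φ v ≤ k) ∧ encode φ = x
  · obtain ⟨φ, h1, h2, rfl⟩ := hx
    rw [reduction_encode k φ h1 h2]
    constructor
    · constructor
      · rintro ⟨φ', h3, -, h4, -⟩
        obtain rfl := encode_injective h3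
        exact ⟨_, rfl, isTwoCNF_reduceCNF k _ h1, h4.reduceCNF,
          fun v => (occurrences_reduceCNF k _ h2 v).trans hk'⟩
      · rintro ⟨ψ, h3, -, h4, -⟩
        obtain rfl := encode_injective h3
        exact ⟨φ, rfl, fun c hc => (h1 c hc).2, satisfiable_of_reduceCNF h2 h4, h2⟩
    · simp only [onStrings_encode]
      exact (size_reduceCNF_le k φ h1 h2 hg hg').trans (Nat.le_add_right _ _)
  · have hbad : ¬ (FewOccurrences k x ∧ Accepts (some (0, false)) x) := by
      rintro ⟨h1, h2⟩
      obtain ⟨φ, h3, rfl⟩ := (exists_of_accepts x).1 h2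
      exact hx ⟨φ, h3, (fewOccurrences_encode k φ).1 h1, rfl⟩
    have hcode : ¬ ∃ ψ, encode ψ = reduction k x := by
      rintro ⟨ψ, h⟩
      rw [reduction, if_neg hbad] at h
      exact not_encode_append_bit _ _ _ h
    constructor
    · constructor
      -- A member of 2SAT_k has no empty clause, since such a clause is never satisfied; so it would
      -- have fallen under the first case.
      · rintro ⟨φ, h1, h2, ⟨σ, hσ⟩, h4⟩
        refine absurd ⟨φ, fun c hc => ⟨?_, h2 c hc⟩, h4, h1⟩ hx
        rintro rfl
        obtain ⟨l, hl, -⟩ := hσ [] hc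
        cases hl
      · rintro ⟨ψ, h, -⟩
        exact absurd ⟨ψ, h⟩ hcode
    · simp only [onStrings_of_not_code g' _ hcode]
      exact Nat.zero_le _

end TwoSat

theorem mainTheorem12 :
    (∀ m ∈ ({TwoSat.mVbl, TwoSat.mCls} : Set (List TwoSat.Sym → ℕ)), ∀ k : ℕ, 3 ≤ k →
      LogSpace.ShortEquiv ⟨TwoSat.twoSAT k, m⟩ ⟨TwoSat.twoSAT 3, m⟩) ∧
    LogSpace.ShortEquiv ⟨TwoSat.twoSAT 3, TwoSat.mVbl⟩ ⟨TwoSat.twoSAT 3, TwoSat.mCls⟩ := by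
  refine ⟨?_, TwoSat.shortReducible 3 3 (by norm_num) le_rfl (Or.inl rfl) (Or.inr rfl),
    TwoSat.shortReducible 3 3 (by norm_num) le_rfl (Or.inr rfl) (Or.inl rfl)⟩
  rintro m (rfl | rfl) k hk
  · exact ⟨TwoSat.shortReducible k 3 (by omega) le_rfl (Or.inl rfl) (Or.inl rfl),
      TwoSat.shortReducible 3 k (by norm_num) hk (Or.inl rfl) (Or.inl rfl)⟩
  · exact ⟨TwoSat.shortReducible k 3 (by omega) le_rfl (Or.inr rfl) (Or.inr rfl),
      TwoSat.shortReducible 3 k (by norm_num) hk (Or.inr rfl) (Or.inr rfl)⟩
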